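/- Let $V$ be a finite-dimensional vector space over $\mathbb R$ or over $\mathbb Q_p$ ($p$ prime), with its canonical Hausdorff vector space topology. A *contraction* of $V$ is a continuous automorphism $T$ of the topological group $V$ such that $T^n x \to 0$ for all $x \in V$. For a Borel probability measure $\mu$ on $V$ and a continuous automorphism $T$ of $V$, let $T(\mu)(B) = \mu(T^{-1}(B))$ for every Borel set $B$, and let $*$ denote convolution. The measure $\mu$ is *full* if it is not supported on a coset $x + W$ of a proper linear subspace $W \subsetneq V$, and *autophage* if $\mu = T(\mu) * S(\mu)$ for some contractions $T, S$ of $V$ with $TS = ST$. Let $T_1, \dots, T_m$ be contractions of $V$ such that $T_i T_j = T_j T_i$ for all $1 \le i, j \le m$, and let $\mu$ be a full Borel probability measure on $V$ such that $\mu = T_1(\mu) * T_2(\mu) * \cdots * T_m(\mu)$. Then $\mu$ is absolutely continuous with respect to Haar measure on $V$, with a bounded continuous density. In particular, every full autophage probability measure on $V$ is absolutely continuous with respect to Haar measure, with a bounded continuous density. -/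

import Mathlib

open MeasureTheory Filter Topology
open scoped BoundedContinuousFunction

/-- A continuous automorphism `T` of a topological (additive) group is a contraction if
`T^n x → 0` for every `x`. -/
def IsContraction {G : Type*} [AddGroup G] [TopologicalSpace G] (T : G ≃ₜ+ G) : Prop :=
  ∀ x : G, Tendsto (fun n : ℕ => T^[n] x) atTop (𝓝 0)

/-- The convolution product `T_1(μ) * (T_2(μ) * (⋯ * T_m(μ)))` of the images of `μ` under
`T_1, …, T_m`; the empty product is the Dirac measure at `0`. -/
noncomputable def convImages {G : Type*} [AddGroup G] [TopologicalSpace G] [MeasurableSpace G]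
    {m : ℕ} (T : Fin m → G ≃ₜ+ G) (μ : Measure G) : Measure G :=
  (List.ofFn fun i => μ.map (T i)).foldr Measure.conv (Measure.dirac 0)

/-- `μ` is autophage if `μ = T(μ) * S(μ)` for some commuting contractions `T`, `S`. -/
def IsAutophage {G : Type*} [AddGroup G] [TopologicalSpace G] [MeasurableSpace G]
    (μ : Measure G) : Prop :=
  ∃ T S : G ≃ₜ+ G, IsContraction T ∧ IsContraction S ∧ Function.Commute T S ∧
    μ = Measure.conv (μ.map T) (μ.map S)

/-- `μ` is full if it is not supported on a coset `x + W` of a proper linear subspace `W`. -/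
def IsFull (K : Type*) {V : Type*} [Field K] [AddCommGroup V] [Module K V] [MeasurableSpace V]
    (μ : Measure V) : Prop :=
  ∀ W : Submodule K V, W ≠ ⊤ → ∀ x : V, μ {y | y - x ∈ W}ᶜ ≠ 0

/-- `μ` is absolutely continuous with respect to `ν`, with a nonnegative bounded continuous
density. -/
def HasBoundedContinuousDensity {V : Type*} [TopologicalSpace V] [MeasurableSpace V]
    (μ ν : Measure V) : Prop :=
  μ ≪ ν ∧ ∃ f : V →ᵇ ℝ, (∀ x, 0 ≤ f x) ∧ μ = ν.withDensity fun x => ENNReal.ofReal (f x)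

/-! Fix a nontrivial continuous character `ψ` of the base field and write `φ` for the Fourier
transform of `μ` on the dual. The convolution equation becomes `|φ(ξ)| = ∏ |φ(ξ ∘ T_i)|`. The plan
is to show that `φ` is integrable and then to invert it.

The set `H` where `|φ| = 1` is a closed subgroup of the dual (`phaseSubgroup`), and `ξ ∈ H` exactly
when every `ξ ∘ T_i` lies in `H`. Fullness says that `H` contains no line. Over `ℝ`, a nonzero
element of `H` has a contracted orbit of nonzero elements of `H` tending to `0`, and a closed
subgroup accumulating at `0` contains a line (`exists_line_of_tendsto_zero`). Over `ℚ_p` this fails,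
since `ℤ_p` accumulates at `0`. There `H` is a `ℤ_p`-module, open in its span, and the equivalence
for the commuting adjoints forces it to be the whole span (`mem_of_mem_span_of_contractions`). In
both cases `H = 0`, so `|φ| < 1` off `0`.

If `m ≥ 2`, then `|φ(ξ)|` is at most the product of two values of `|φ|` at points whose norms are
smaller by at most a fixed factor `C`. Iterating gives `|φ(ξ)| ≤ θ ^ 2 ^ d` for `‖ξ‖ ≥ C ^ d`
(`exists_superpolynomial_decay`), while volumes of balls of radius `C ^ d` grow only geometrically
in `d`. If `m < 2`, then `|φ|` is identically `1` and the space is zero. Inversion for integrable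
`φ` is carried out over both fields at once, with a Gaussian or the indicator of the unit ball as
summability kernel. -/

/-- The Fourier transform of a measure on `V`, as a function on the dual of `V`, with respect to
an additive character `ψ` of the base field. -/
noncomputable def dualCharFun {K V : Type*} [NontriviallyNormedField K] [NormedAddCommGroup V]
    [NormedSpace K V] [MeasurableSpace V] (ψ : AddChar K Circle) (μ : Measure V)
    (ξ : V →L[K] K) : ℂ :=
  ∫ x, (ψ (ξ x) : ℂ) ∂μ

/-- The functionals `ξ` for which `ψ ∘ ξ` is almost everywhere constant. -/
def phaseSubgroup {K V : Type*} [NontriviallyNormedField K] [NormedAddCommGroup V]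
    [NormedSpace K V] [MeasurableSpace V] (ψ : AddChar K Circle) (μ : Measure V) :
    AddSubgroup (V →L[K] K) where
  carrier := {ξ | ∃ c : Circle, ∀ᵐ x ∂μ, ψ (ξ x) = c}
  zero_mem' := ⟨1, by simp⟩
  add_mem' := by
    rintro ξ η ⟨c, hc⟩ ⟨d, hd⟩
    refine ⟨c * d, ?_⟩
    filter_upwards [hc, hd] with x hx hy
    simp [AddChar.map_add_eq_mul, hx, hy]
  neg_mem' := by
    rintro ξ ⟨c, hc⟩
    refine ⟨c⁻¹, ?_⟩
    filter_upwards [hc] with x hx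
    simp [AddChar.map_neg_eq_inv, hx]

/-! ### The Fourier transform and its phase subgroup. -/

lemma continuous_circle_coe : Continuous fun z : Circle => (z : ℂ) := continuous_subtype_val

lemma continuous_character_apply {K V : Type*} [NontriviallyNormedField K]
    [NormedAddCommGroup V] [NormedSpace K V] {ψ : AddChar K Circle} (hψ : Continuous ψ)
    (ξ : V →L[K] K) : Continuous fun x => (ψ (ξ x) : ℂ) :=
  continuous_circle_coe.comp (hψ.comp ξ.continuous)

section DualCharFun

variable {K V : Type*} [NontriviallyNormedField K] [NormedAddCommGroup V]
  [NormedSpace K V] [MeasurableSpace V] {ψ : AddChar K Circle} {μ : Measure V}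
  [IsProbabilityMeasure μ]

lemma norm_dualCharFun_le_one (ξ : V →L[K] K) : ‖dualCharFun ψ μ ξ‖ ≤ 1 := by
  refine (norm_integral_le_of_norm_le_const (C := 1)
    (ae_of_all _ fun x => (Circle.norm_coe _).le)).trans ?_
  simp

lemma continuous_dualCharFun (hψ : Continuous ψ) [BorelSpace V] [SecondCountableTopology V] :
    Continuous (dualCharFun ψ μ) := by
  refine continuous_of_dominated (bound := fun _ => 1)
    (fun ξ => (continuous_character_apply hψ ξ).aestronglyMeasurable)
    (fun ξ => ae_of_all _ fun x => (Circle.norm_coe _).le) (by simp) ?_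
  refine ae_of_all _ fun x => continuous_circle_coe.comp (hψ.comp ?_)
  fun_prop

/-- Strict convexity of the disc: an average of unit complex numbers has modulus `1` only if they
agree almost everywhere. -/
lemma mem_phaseSubgroup_iff (ξ : V →L[K] K) :
    ξ ∈ phaseSubgroup ψ μ ↔ ‖dualCharFun ψ μ ξ‖ = 1 := by
  constructor
  · rintro ⟨c, hc⟩
    have : dualCharFun ψ μ ξ = c := by
      have h : (fun x => (ψ (ξ x) : ℂ)) =ᵐ[μ] fun _ => (c : ℂ) := by
        filter_upwards [hc] with x hx using by rw [hx]
      rw [dualCharFun, integral_congr_ae h]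
      simp
    rw [this, Circle.norm_coe]
  · intro h
    rcases ae_eq_const_or_norm_integral_lt_of_norm_le_const (μ := μ) (C := 1)
      (f := fun x => (ψ (ξ x) : ℂ)) (ae_of_all _ fun x => (Circle.norm_coe _).le) with h1 | h1
    · obtain ⟨x₀, hx₀⟩ := h1.exists
      refine ⟨ψ (ξ x₀), ?_⟩
      filter_upwards [h1] with x hx
      exact Circle.ext (hx.trans hx₀.symm)
    · rw [dualCharFun] at h
      simp [h] at h1

lemma isClosed_phaseSubgroup (hψ : Continuous ψ) [BorelSpace V] [SecondCountableTopology V] :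
    IsClosed (phaseSubgroup ψ μ : Set (V →L[K] K)) := by
  have : (phaseSubgroup ψ μ : Set (V →L[K] K)) = {ξ | ‖dualCharFun ψ μ ξ‖ = 1} := by
    ext ξ; exact mem_phaseSubgroup_iff ξ
  rw [this]
  exact isClosed_eq (continuous_dualCharFun hψ).norm continuous_const

/-- If `μ` is full, then the phase subgroup contains no line. -/
lemma eq_zero_of_forall_smul_mem_phaseSubgroup (hψ : Continuous ψ) (hψ1 : ψ ≠ 1)
    [SecondCountableTopology K] (hμ : IsFull K μ) {η : V →L[K] K}
    (hη : ∀ t : K, t • η ∈ phaseSubgroup ψ μ) : η = 0 := by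
  obtain ⟨D, hDc, hDd⟩ := TopologicalSpace.exists_countable_dense K
  choose c hc using hη
  -- The exceptional null set depends on `t`; restricting to a countable dense set of `t` leaves a
  -- single null set.
  have hae : ∀ᵐ x ∂μ, ∀ t ∈ D, ψ ((t • η) x) = c t := (ae_ball_iff hDc).2 fun t _ => hc t
  obtain ⟨x₀, hx₀⟩ := hae.exists
  have key : ∀ᵐ x ∂μ, η x = η x₀ := by
    filter_upwards [hae] with x hx
    by_contra hne
    have hs : η x - η x₀ ≠ 0 := sub_ne_zero.2 hne
    have h1 : ∀ t : K, ψ (t * (η x - η x₀)) = 1 := by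
      have := Continuous.ext_on (f := fun t => ψ (t * (η x - η x₀))) (g := fun _ => 1) hDd
        (hψ.comp (by fun_prop)) continuous_const fun t ht => by
          have := (hx t ht).trans (hx₀ t ht).symm
          simp only [smul_apply, smul_eq_mul] at this
          simp [mul_sub, AddChar.map_sub_eq_div, this]
      exact fun t => congrFun this t
    refine hψ1 (AddChar.eq_one_iff.2 fun a => ?_)
    have := h1 (a / (η x - η x₀))
    rwa [div_mul_cancel₀ _ hs] at this
  by_contra hne
  refine hμ (LinearMap.ker η.toLinearMap) ?_ x₀ ?_
  · rintro h
    rw [LinearMap.ker_eq_top] at h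
    exact hne (ContinuousLinearMap.coe_injective h)
  · rw [ae_iff] at key
    convert key using 2
    ext x
    simp [sub_eq_zero]

end DualCharFun

/-! ### Decay and integrability. -/

/-- A continuous function `Φ ≤ 1` on a proper space with `Φ < 1` away from `0` and
`Φ x ≤ Φ (A x) * Φ (B x)`, where `A` and `B` shrink norms at most by the factor `C` and iterates
of `A` contract, decays faster than any power. -/
lemma exists_superpolynomial_decay {E : Type*} [NormedAddCommGroup E] [ProperSpace E]
    {Φ : E → ℝ} (hΦ : Continuous Φ) (h0 : ∀ x, 0 ≤ Φ x) (h1 : ∀ x, Φ x ≤ 1)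
    (hlt : ∀ x, x ≠ 0 → Φ x < 1) {A B : E → E} {C : ℝ} (hC : 1 ≤ C)
    (hA : ∀ x, ‖x‖ ≤ C * ‖A x‖) (hB : ∀ x, ‖x‖ ≤ C * ‖B x‖)
    (hAn : ∀ x, Tendsto (fun n : ℕ => A^[n] x) atTop (𝓝 0))
    (hAB : ∀ x, Φ x ≤ Φ (A x) * Φ (B x)) :
    ∃ θ : ℝ, 0 < θ ∧ θ < 1 ∧ ∀ (d : ℕ) (x : E), C ^ d ≤ ‖x‖ → Φ x ≤ θ ^ 2 ^ d := by
  have hC0 : 0 < C := by linarith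
  -- An `A`-orbit starting at norm at least `1` first enters the unit ball inside this shell,
  -- because one step divides the norm by at most `C`.
  let S : Set E := {x | 1 / C ≤ ‖x‖ ∧ ‖x‖ ≤ 1}
  have hS : IsCompact S := by
    refine Metric.isCompact_of_isClosed_isBounded ?_ ?_
    · exact (isClosed_le continuous_const continuous_norm).inter
        (isClosed_le continuous_norm continuous_const)
    · exact (Metric.isBounded_closedBall (x := (0 : E)) (r := 1)).subset fun x hx => by
        simpa using hx.2
  obtain ⟨θ, hθ0, hθ1, hθ⟩ : ∃ θ : ℝ, 0 < θ ∧ θ < 1 ∧ ∀ x ∈ S, Φ x ≤ θ := by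
    rcases S.eq_empty_or_nonempty with he | hne
    · exact ⟨1 / 2, by norm_num, by norm_num, by simp [he]⟩
    · obtain ⟨x, hx, hmax⟩ := hS.exists_isMaxOn hne hΦ.continuousOn
      have hx0 : x ≠ 0 := by
        rintro rfl
        have : 1 / C ≤ 0 := by simpa using hx.1
        have : 0 < 1 / C := by positivity
        linarith
      -- The maximum with `1 / 2` keeps `θ` positive even if `Φ` vanishes on `S`.
      exact ⟨max (Φ x) (1 / 2), by positivity, max_lt (hlt x hx0) (by norm_num),
        fun y hy => (hmax hy).trans (le_max_left _ _)⟩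
  have hA1 : ∀ x, Φ x ≤ Φ (A x) := fun x =>
    (hAB x).trans (mul_le_of_le_one_right (h0 _) (h1 _))
  refine ⟨θ, hθ0, hθ1, fun d => ?_⟩
  induction d with
  | zero =>
    intro x hx
    have hx1 : 1 ≤ ‖x‖ := by simpa using hx
    have hex : ∃ n : ℕ, ‖A^[n] x‖ ≤ 1 := by
      have : ∀ᶠ n in atTop, ‖A^[n] x‖ < 1 := by
        have := (hAn x).norm
        rw [norm_zero] at this
        exact this.eventually (gt_mem_nhds one_pos)
      obtain ⟨n, hn⟩ := this.exists
      exact ⟨n, hn.le⟩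
    have hmono : ∀ n : ℕ, Φ x ≤ Φ (A^[n] x) := by
      intro n
      induction n with
      | zero => simp
      | succ n ih => rw [Function.iterate_succ_apply']; exact ih.trans (hA1 _)
    classical
    have hfind := Nat.find_spec hex
    rw [pow_zero, pow_one]
    refine (hmono (Nat.find hex)).trans (hθ _ ⟨?_, hfind⟩)
    rcases Nat.eq_zero_or_pos (Nat.find hex) with hz | hpos
    · rw [hz]
      refine le_trans ?_ hx1
      rw [div_le_one hC0]; exact hC
    · obtain ⟨k, hk⟩ := Nat.exists_eq_succ_of_ne_zero hpos.ne'
      have hlt' : 1 < ‖A^[k] x‖ := not_le.1 (Nat.find_min hex (by omega))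
      rw [hk, Function.iterate_succ_apply', div_le_iff₀' hC0]
      exact hlt'.le.trans (hA _)
  | succ d ih =>
    intro x hx
    -- Both `A x` and `B x` stay outside radius `C ^ d`, so the two factors double the exponent of
    -- `θ`.
    have hstep : ∀ y : E, ‖x‖ ≤ C * ‖y‖ → C ^ d ≤ ‖y‖ := fun y hy => by
      have : C * C ^ d ≤ C * ‖y‖ := by rw [← pow_succ']; exact hx.trans hy
      exact le_of_mul_le_mul_left this hC0
    calc Φ x ≤ Φ (A x) * Φ (B x) := hAB x
      _ ≤ θ ^ 2 ^ d * θ ^ 2 ^ d :=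
        mul_le_mul (ih _ (hstep _ (hA x))) (ih _ (hstep _ (hB x))) (h0 _) (by positivity)
      _ = θ ^ 2 ^ (d + 1) := by rw [← pow_add]; congr 1; ring

section Scaling

variable {K X : Type*} [NontriviallyNormedField K] [ProperSpace K] [NormedAddCommGroup X]
  [NormedSpace K X] [FiniteDimensional K X] [MeasurableSpace X] [BorelSpace X]
  [SecondCountableTopology X] (ν : Measure X) [ν.IsAddHaarMeasure]

/-- A homothety rescales Haar measure. -/
lemma exists_map_smul_eq_smul {t : K} (ht : t ≠ 0) :
    ∃ J : NNReal, J ≠ 0 ∧ ν.map (fun x => t • x) = J • ν := by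
  have : ProperSpace X := FiniteDimensional.proper K X
  let e : X ≃L[K] X := ContinuousLinearEquiv.smulLeft (Units.mk0 t ht)
  have h1 : (ν.map e).IsAddHaarMeasure := e.isAddHaarMeasure_map ν
  have h2 := Measure.isAddLeftInvariant_eq_smul (ν.map e) ν
  exact ⟨_, (Measure.addHaarScalarFactor_pos_of_isAddHaarMeasure (ν.map e) ν).ne', h2⟩

/-- A measurable function bounded by `θ ^ 2 ^ d` outside the ball of radius `C ^ d` is
integrable. -/
lemma integrable_of_superpolynomial_decay {Φ : X → ℂ} (hΦ : Continuous Φ) (h1 : ∀ x, ‖Φ x‖ ≤ 1)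
    {t : K} (ht : 1 < ‖t‖) {θ : ℝ} (hθ0 : 0 < θ) (hθ1 : θ < 1)
    (h : ∀ (d : ℕ) (x : X), ‖t‖ ^ d ≤ ‖x‖ → ‖Φ x‖ ≤ θ ^ 2 ^ d) : Integrable Φ ν := by
  have : ProperSpace X := FiniteDimensional.proper K X
  have ht0 : t ≠ 0 := norm_pos_iff.1 (by linarith)
  obtain ⟨J, hJ0, hJ⟩ := exists_map_smul_eq_smul ν ht0
  let U : ℕ → Set X := fun d => Metric.closedBall 0 (‖t‖ ^ d)
  have hUm : ∀ d, MeasurableSet (U d) := fun d => Metric.isClosed_closedBall.measurableSet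
  -- Multiplication by `t` maps each ball onto the next, so the volumes form a geometric sequence.
  have hU : ∀ d, ν (U d) = (J⁻¹ : NNReal) ^ d * ν (U 0) := by
    intro d
    induction d with
    | zero => simp
    | succ d ih =>
      have h2 : ν (U d) = J * ν (U (d + 1)) := by
        have h3 := congrArg (fun m => m (U (d + 1))) hJ
        simp only [Measure.smul_apply] at h3
        rw [Measure.map_apply (by fun_prop) (hUm _)] at h3
        rw [show (J : ENNReal) * ν (U (d + 1)) = J • ν (U (d + 1)) from rfl, ← h3]
        congr 1
        ext x
        simp only [U, Metric.mem_closedBall, dist_zero_right, Set.mem_preimage, norm_smul,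
          pow_succ']
        exact (mul_le_mul_iff_right₀ (by linarith)).symm
      rw [pow_succ', mul_assoc, ← ih, h2, ← mul_assoc, ← ENNReal.coe_mul, inv_mul_cancel₀ hJ0]
      simp
  refine ⟨hΦ.aestronglyMeasurable, ?_⟩
  -- Outside `U 0`, the point `x` lies in some shell `U (d + 1) \ U d`, where the decay estimate of
  -- index `d` applies.
  have hbound : ∀ x, ‖Φ x‖ₑ ≤ (U 0).indicator 1 x +
      ∑' d, (U (d + 1)).indicator (fun _ => ENNReal.ofReal (θ ^ 2 ^ d)) x := by
    intro x
    by_cases hx : x ∈ U 0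
    · refine le_trans ?_ le_self_add
      rw [Set.indicator_of_mem hx]
      simpa [← ofReal_norm] using h1 x
    · refine le_trans ?_ le_add_self
      have hx1 : 1 < ‖x‖ := by simpa [U] using hx
      have hex : ∃ n : ℕ, ‖x‖ ≤ ‖t‖ ^ n := (pow_unbounded_of_one_lt _ ht).imp fun _ h => h.le
      classical
      have hn0 : Nat.find hex ≠ 0 := by
        intro h0
        have := Nat.find_spec hex
        rw [h0, pow_zero] at this
        linarith
      obtain ⟨d, hd⟩ := Nat.exists_eq_succ_of_ne_zero hn0
      have hlt : ‖t‖ ^ d < ‖x‖ := not_le.1 (Nat.find_min hex (by omega))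
      have hle := Nat.find_spec hex
      rw [hd] at hle
      refine le_trans ?_ (ENNReal.le_tsum d)
      rw [Set.indicator_of_mem (by simpa [U] using hle), ← ofReal_norm]
      exact ENNReal.ofReal_le_ofReal (h d x hlt.le)
  have hfin : ν (U 0) < ⊤ := measure_closedBall_lt_top
  refine (lintegral_mono hbound).trans_lt ?_
  rw [lintegral_add_left (measurable_one.indicator (hUm 0)), lintegral_tsum
    (fun d => (measurable_const.indicator (hUm _)).aemeasurable)]
  simp_rw [lintegral_indicator_const (hUm _), lintegral_indicator_one (hUm _)]
  refine ENNReal.add_lt_top.2 ⟨hfin, ?_⟩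
  rw [tsum_congr fun d => by rw [hU (d + 1), ← mul_assoc], ENNReal.tsum_mul_right]
  refine ENNReal.mul_lt_top ?_ hfin
  -- Consecutive terms have ratio `θ ^ 2 ^ d * J⁻¹`, which tends to `0` whatever the size of `J⁻¹`.
  have hsum : Summable fun d : ℕ => θ ^ 2 ^ d * ((J⁻¹ : NNReal) : ℝ) ^ (d + 1) := by
    have hJp : (0 : ℝ) < ((J⁻¹ : NNReal) : ℝ) := by positivity
    refine summable_of_ratio_test_tendsto_lt_one (l := 0) one_pos
      (Eventually.of_forall fun n => by positivity) ?_
    have : Tendsto (fun d : ℕ => θ ^ 2 ^ d * ((J⁻¹ : NNReal) : ℝ)) atTop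
        (𝓝 (0 * ((J⁻¹ : NNReal) : ℝ))) :=
      ((tendsto_pow_atTop_nhds_zero_of_lt_one hθ0.le hθ1).comp
        (tendsto_pow_atTop_atTop_of_one_lt one_lt_two)).mul_const _
    rw [zero_mul] at this
    refine this.congr fun d => ?_
    rw [Real.norm_of_nonneg (by positivity), Real.norm_of_nonneg (by positivity)]
    rw [eq_div_iff (by positivity)]
    rw [pow_succ 2 d, pow_mul]
    ring
  have := hsum.tsum_ofReal_lt_top
  refine lt_of_eq_of_lt (tsum_congr fun d => ?_) this
  rw [ENNReal.ofReal_mul (by positivity), ENNReal.ofReal_pow (NNReal.coe_nonneg _),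
    ENNReal.ofReal_coe_nnreal]

end Scaling

/-! ### Fourier inversion through a summability kernel. -/

lemma integral_comp_smul_eq {K X E : Type*} [NontriviallyNormedField K]
    [NormedAddCommGroup X] [NormedSpace K X] [MeasurableSpace X] [BorelSpace X] {ν : Measure X}
    [NormedAddCommGroup E] [NormedSpace ℝ E] {t : K} (ht : t ≠ 0)
    {J : NNReal} (hJ : ν.map (fun x => t • x) = J • ν) (f : X → E) :
    ∫ x, f (t • x) ∂ν = (J : ℝ) • ∫ x, f x ∂ν := by
  have hm : MeasurableEmbedding fun x : X => t • x :=
    (Homeomorph.smulOfNeZero t ht).measurableEmbedding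
  rw [← hm.integral_map, hJ, integral_smul_nnreal_measure]
  rfl

lemma continuous_character_pairing {K X : Type*} [NontriviallyNormedField K]
    [NormedAddCommGroup X] [NormedSpace K X] {ψ : AddChar K Circle} (hψ : Continuous ψ)
    (L : X ≃L[K] (X →L[K] K)) : Continuous fun p : X × X => (ψ (L p.1 p.2) : ℂ) :=
  continuous_circle_coe.comp (hψ.comp (by fun_prop))

section Density

variable {K X : Type*} [NontriviallyNormedField K] [ProperSpace K] [NormedAddCommGroup X]
  [NormedSpace K X] [FiniteDimensional K X] [MeasurableSpace X] [BorelSpace X]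
  [SecondCountableTopology X] {ν : Measure X} [ν.IsAddHaarMeasure]

/-- A summability kernel for Fourier inversion on `X` with respect to the pairing
`(ξ, x) ↦ ψ (L ξ x)`: an integrable `G` with `G 0 = 1`, continuous at `0`, whose Fourier
transform is a nonnegative integrable function with positive integral. -/
structure IsSummabilityKernel (ψ : AddChar K Circle) (L : X ≃L[K] (X →L[K] K)) (ν : Measure X)
    (G k : X → ℝ) : Prop where
  integrable : Integrable G ν
  norm_le_one : ∀ ξ, ‖G ξ‖ ≤ 1
  continuousAt_zero : ContinuousAt G 0
  apply_zero : G 0 = 1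
  continuous_transform : Continuous k
  transform_nonneg : ∀ x, 0 ≤ k x
  integrable_transform : Integrable k ν
  integral_transform_pos : 0 < ∫ x, k x ∂ν
  transform_eq : ∀ x, (k x : ℂ) = ∫ ξ, (G ξ : ℂ) * ψ (L ξ x) ∂ν

lemma integrable_comp_smul_of_ne_zero {E : Type*} [NormedAddCommGroup E] {t : K}
    (ht : t ≠ 0) {f : X → E} (hf : Integrable f ν) : Integrable (fun x => f (t • x)) ν := by
  have hm : MeasurableEmbedding fun x : X => t • x :=
    (Homeomorph.smulOfNeZero t ht).measurableEmbedding
  obtain ⟨J, -, hJ⟩ := exists_map_smul_eq_smul ν ht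
  refine (hm.integrable_map_iff (g := f)).1 ?_
  rw [hJ]
  exact hf.smul_measure_nnreal

variable {ψ : AddChar K Circle} {L : X ≃L[K] (X →L[K] K)} {G k : X → ℝ} {μ : Measure X}
  [IsProbabilityMeasure μ]

/-- The regularised Fourier inversion integral is a rescaled convolution with the kernel. -/
lemma integral_kernel_comp_smul (hψ : Continuous ψ) (hk : IsSummabilityKernel ψ L ν G k)
    {t : K} (ht : t ≠ 0) {J : NNReal} (hJ : ν.map (fun x => t • x) = J • ν) (z : X) :
    ((∫ y, k (t • (y - z)) ∂μ : ℝ) : ℂ) =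
      J * ∫ ξ, (G (t⁻¹ • ξ) : ℂ) * (dualCharFun ψ μ (L ξ) * ψ (L ξ (-z))) ∂ν := by
  have : ProperSpace X := FiniteDimensional.proper K X
  have h1 : ∀ y, (k (t • (y - z)) : ℂ) =
      J * ∫ ξ, (G (t⁻¹ • ξ) : ℂ) * ψ (L ξ (y - z)) ∂ν := by
    intro y
    rw [hk.transform_eq]
    have := integral_comp_smul_eq (ν := ν) ht hJ
      (fun ξ => (G (t⁻¹ • ξ) : ℂ) * ψ (L ξ (y - z)))
    rw [Complex.real_smul] at this
    rw [show ((J : ℝ) : ℂ) = (J : ℂ) from rfl] at this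
    rw [← this]
    refine integral_congr_ae (ae_of_all _ fun ξ => ?_)
    simp [inv_smul_smul₀ ht]
  rw [← integral_complex_ofReal]
  simp_rw [h1]
  rw [integral_const_mul]
  congr 1
  rw [integral_integral_swap]
  · refine integral_congr_ae (ae_of_all _ fun ξ => ?_)
    simp only
    rw [dualCharFun, ← integral_mul_const, ← integral_const_mul]
    refine integral_congr_ae (ae_of_all _ fun y => ?_)
    simp [sub_eq_add_neg, AddChar.map_add_eq_mul]
  · have hG : Integrable (fun ξ => (G (t⁻¹ • ξ) : ℂ)) ν :=
      (integrable_comp_smul_of_ne_zero (inv_ne_zero ht) hk.integrable).ofReal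
    have h2 : Integrable (fun p : X × X => (1 : ℂ) * (G (t⁻¹ • p.2) : ℂ)) (μ.prod ν) :=
      (integrable_const (1 : ℂ)).mul_prod hG
    refine (h2.mul_bdd (c := 1) (g := fun p : X × X => (ψ (L p.2 (p.1 - z)) : ℂ)) ?_
      (ae_of_all _ fun p => (Circle.norm_coe _).le)).congr
      (ae_of_all _ fun p => by simp [Function.uncurry])
    exact ((continuous_character_pairing hψ L).comp
      (by fun_prop : Continuous fun p : X × X => (p.2, p.1 - z))).aestronglyMeasurable

/-- Fourier inversion for finite measures: if the Fourier transform of `μ` is integrable, then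
`μ` has a bounded continuous density. -/
theorem hasBoundedContinuousDensity_of_integrable (hψ : Continuous ψ)
    (hk : IsSummabilityKernel ψ L ν G k)
    (hμ : Integrable (fun ξ => dualCharFun ψ μ (L ξ)) ν) :
    HasBoundedContinuousDensity μ ν := by
  have : ProperSpace X := FiniteDimensional.proper K X
  set Φ : X → ℂ := fun ξ => dualCharFun ψ μ (L ξ) with hΦ
  obtain ⟨t, ht⟩ := NormedField.exists_one_lt_norm K
  have ht0 : t ≠ 0 := norm_pos_iff.1 (by linarith)
  have htn0 : ∀ n : ℕ, t ^ n ≠ 0 := fun n => pow_ne_zero n ht0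
  have hs : Tendsto (fun n : ℕ => (t ^ n)⁻¹) atTop (𝓝 0) := by
    simp_rw [← inv_pow]
    exact tendsto_pow_atTop_nhds_zero_of_norm_lt_one (by
      rw [norm_inv]; exact inv_lt_one_of_one_lt₀ ht)
  choose J hJ0 hJ using fun n => exists_map_smul_eq_smul ν (htn0 n)
  -- `F` is the inversion integral; `Fn n` smears `μ` by the kernel `k` concentrated at scale `t ^
  -- (-n)`. The factor `(J n)⁻¹` keeps the mass of the kernel equal to `∫ k`, so the limit will be
  -- `∫ k` times the density.
  let F : X → ℂ := fun z => ∫ ξ, Φ ξ * ψ (L ξ (-z)) ∂ν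
  let Fn : ℕ → X → ℝ := fun n z => (J n : ℝ)⁻¹ * ∫ y, k (t ^ n • (y - z)) ∂μ
  have hFn : ∀ n z, (Fn n z : ℂ) =
      ∫ ξ, (G ((t ^ n)⁻¹ • ξ) : ℂ) * (Φ ξ * ψ (L ξ (-z))) ∂ν := by
    intro n z
    simp only [Fn]
    rw [Complex.ofReal_mul, integral_kernel_comp_smul hψ hk (htn0 n) (hJ n) z, ← mul_assoc]
    have : ((J n : ℝ) : ℂ) ≠ 0 := by exact_mod_cast hJ0 n
    rw [show (((J n : ℝ)⁻¹ : ℝ) : ℂ) * (J n : ℂ) = 1 by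
      rw [Complex.ofReal_inv]; exact inv_mul_cancel₀ this, one_mul]
  have hchar : ∀ z, Continuous fun ξ => (ψ (L ξ (-z)) : ℂ) := fun z =>
    (continuous_character_pairing hψ L).comp (by fun_prop : Continuous fun ξ : X => (ξ, -z))
  have hmeas : ∀ z, AEStronglyMeasurable (fun ξ => Φ ξ * (ψ (L ξ (-z)) : ℂ)) ν := fun z =>
    hμ.1.mul (hchar z).aestronglyMeasurable
  have hnorm : ∀ z ξ, ‖Φ ξ * (ψ (L ξ (-z)) : ℂ)‖ = ‖Φ ξ‖ := fun z ξ => by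
    rw [norm_mul, Circle.norm_coe, mul_one]
  have hnormG : ∀ n z ξ, ‖(G ((t ^ n)⁻¹ • ξ) : ℂ) * (Φ ξ * ψ (L ξ (-z)))‖ ≤ ‖Φ ξ‖ :=
    fun n z ξ => by
      rw [norm_mul, hnorm, Complex.norm_real]
      exact mul_le_of_le_one_left (norm_nonneg _) (hk.norm_le_one _)
  have hFcont : Continuous F := by
    refine continuous_of_dominated (bound := fun ξ => ‖Φ ξ‖) hmeas
      (fun z => ae_of_all _ fun ξ => (hnorm z ξ).le) hμ.norm (ae_of_all _ fun ξ => ?_)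
    exact continuous_const.mul ((continuous_character_pairing hψ L).comp
      (by fun_prop : Continuous fun z : X => (ξ, -z)))
  have hFbound : ∀ z, ‖F z‖ ≤ ∫ ξ, ‖Φ ξ‖ ∂ν := fun z =>
    (norm_integral_le_integral_norm _).trans_eq (by simp_rw [hnorm])
  have hFnbound : ∀ n z, ‖Fn n z‖ ≤ ∫ ξ, ‖Φ ξ‖ ∂ν := fun n z => by
    rw [← Complex.norm_real, hFn]
    exact norm_integral_le_of_norm_le hμ.norm (ae_of_all _ (hnormG n z))
  have hlimC : ∀ z, Tendsto (fun n => (Fn n z : ℂ)) atTop (𝓝 (F z)) := by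
    intro z
    simp_rw [hFn]
    refine tendsto_integral_of_dominated_convergence (fun ξ => ‖Φ ξ‖) (fun n => ?_) hμ.norm
      (fun n => ae_of_all _ (hnormG n z)) (ae_of_all _ fun ξ => ?_)
    · exact (integrable_comp_smul_of_ne_zero (inv_ne_zero (htn0 n))
        hk.integrable).ofReal.1.mul (hmeas z)
    · have h1 : Tendsto (fun n : ℕ => (t ^ n)⁻¹ • ξ) atTop (𝓝 0) := by
        simpa using hs.smul_const ξ
      have h2 : Tendsto (fun n : ℕ => G ((t ^ n)⁻¹ • ξ)) atTop (𝓝 1) := by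
        rw [← hk.apply_zero]
        exact hk.continuousAt_zero.tendsto.comp h1
      have h3 : Tendsto (fun n : ℕ => (G ((t ^ n)⁻¹ • ξ) : ℂ)) atTop (𝓝 1) := by
        exact_mod_cast (Complex.continuous_ofReal.tendsto 1).comp h2
      simpa using h3.mul_const (Φ ξ * (ψ (L ξ (-z)) : ℂ))
  let f : X → ℝ := fun z => (F z).re
  have hfcont : Continuous f := Complex.continuous_re.comp hFcont
  have hfbound : ∀ z, ‖f z‖ ≤ ∫ ξ, ‖Φ ξ‖ ∂ν := fun z =>
    (Complex.abs_re_le_norm _).trans (hFbound z)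
  have hlim : ∀ z, Tendsto (fun n => Fn n z) atTop (𝓝 (f z)) := fun z => by
    exact (Complex.continuous_re.tendsto _).comp (hlimC z)
  have hf0 : ∀ z, 0 ≤ f z := fun z => ge_of_tendsto' (hlim z) fun n =>
    mul_nonneg (by positivity) (integral_nonneg fun y => hk.transform_nonneg _)
  have hkbdd : ∀ x, ‖k x‖ ≤ ∫ ξ, ‖G ξ‖ ∂ν := fun x => by
    rw [← Complex.norm_real, hk.transform_eq]
    refine norm_integral_le_of_norm_le hk.integrable.norm (ae_of_all _ fun ξ => ?_)
    rw [norm_mul, Circle.norm_coe, mul_one, Complex.norm_real]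
  have hFnmeas : ∀ n, AEStronglyMeasurable (Fn n) ν := fun n => by
    refine AEStronglyMeasurable.const_mul ?_ _
    have : StronglyMeasurable fun p : X × X => k (t ^ n • (p.2 - p.1)) :=
      (hk.continuous_transform.comp (by fun_prop)).stronglyMeasurable
    exact this.integral_prod_right.aestronglyMeasurable
  set c := ∫ x, k x ∂ν with hc
  have hc0 : 0 < c := hk.integral_transform_pos
  -- The integral of `g * Fn n` has two limits: directly, by dominated convergence, and after Fubini
  -- and rescaling, where `g (y - (t ^ n)⁻¹ • x)` tends to `g y`.
  have key : ∀ g : X → ℝ, Continuous g → HasCompactSupport g →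
      ∫ z, g z * f z ∂ν = (∫ y, g y ∂μ) * c := by
    intro g hg hgc
    have hgi : Integrable g ν := hg.integrable_of_hasCompactSupport hgc
    obtain ⟨M, hM⟩ := hgc.exists_bound_of_continuous hg
    have hL : Tendsto (fun n => ∫ z, g z * Fn n z ∂ν) atTop (𝓝 (∫ z, g z * f z ∂ν)) := by
      refine tendsto_integral_of_dominated_convergence
        (fun z => ‖g z‖ * ∫ ξ, ‖Φ ξ‖ ∂ν) (fun n => hgi.1.mul (hFnmeas n))
        (hgi.norm.mul_const _) (fun n => ae_of_all _ fun z => ?_)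
        (ae_of_all _ fun z => (hlim z).const_mul _)
      rw [norm_mul]
      exact mul_le_mul_of_nonneg_left (hFnbound n z) (norm_nonneg _)
    have hswap : ∀ n, ∫ z, g z * Fn n z ∂ν =
        ∫ y, ∫ x, g (y - (t ^ n)⁻¹ • x) * k x ∂ν ∂μ := by
      intro n
      have h1 : ∀ y, ∫ z, g z * k (t ^ n • (y - z)) ∂ν =
          J n * ∫ x, g (y - (t ^ n)⁻¹ • x) * k x ∂ν := by
        intro y
        have h2 := integral_comp_smul_eq (ν := ν) (htn0 n) (hJ n)
          (fun x => g (y - (t ^ n)⁻¹ • x) * k x)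
        rw [smul_eq_mul] at h2
        rw [← h2, ← integral_sub_left_eq_self _ ν y]
        refine integral_congr_ae (ae_of_all _ fun z => ?_)
        simp [inv_smul_smul₀ (htn0 n)]
      have h3 : ∫ z, g z * Fn n z ∂ν =
          (J n : ℝ)⁻¹ * ∫ z, ∫ y, g z * k (t ^ n • (y - z)) ∂μ ∂ν := by
        rw [← integral_const_mul]
        refine integral_congr_ae (ae_of_all _ fun z => ?_)
        simp only [Fn, integral_const_mul]
        ring
      rw [h3, integral_integral_swap]
      · simp_rw [h1]
        rw [integral_const_mul, ← mul_assoc, inv_mul_cancel₀ (by exact_mod_cast hJ0 n), one_mul]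
      · have h4 : Integrable (fun p : X × X => g p.1 * (1 : ℝ)) (ν.prod μ) :=
          hgi.mul_prod (integrable_const (1 : ℝ))
        refine (h4.mul_bdd (c := ∫ ξ, ‖G ξ‖ ∂ν)
          (g := fun p : X × X => k (t ^ n • (p.2 - p.1))) ?_
          (ae_of_all _ fun p => hkbdd _)).congr (ae_of_all _ fun p => by simp [Function.uncurry])
        exact (hk.continuous_transform.comp (by fun_prop)).aestronglyMeasurable
    have hR : Tendsto (fun n => ∫ y, ∫ x, g (y - (t ^ n)⁻¹ • x) * k x ∂ν ∂μ) atTop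
        (𝓝 (∫ y, ∫ x, g y * k x ∂ν ∂μ)) := by
      have hpt : ∀ y x n, ‖g (y - (t ^ n)⁻¹ • x) * k x‖ ≤ M * ‖k x‖ := fun y x n => by
        rw [norm_mul]
        exact mul_le_mul_of_nonneg_right (hM _) (norm_nonneg _)
      refine tendsto_integral_of_dominated_convergence (fun _ => ∫ x, M * ‖k x‖ ∂ν)
        (fun n => ?_) (integrable_const _) (fun n => ae_of_all _ fun y =>
          norm_integral_le_of_norm_le (hk.integrable_transform.norm.const_mul M)
            (ae_of_all _ fun x => hpt y x n)) (ae_of_all _ fun y => ?_)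
      · have : StronglyMeasurable fun p : X × X => g (p.1 - (t ^ n)⁻¹ • p.2) * k p.2 :=
          ((hg.comp (by fun_prop)).mul
            (hk.continuous_transform.comp continuous_snd)).stronglyMeasurable
        exact this.integral_prod_right.aestronglyMeasurable
      · refine tendsto_integral_of_dominated_convergence (fun x => M * ‖k x‖)
          (fun n => ?_) (hk.integrable_transform.norm.const_mul M)
          (fun n => ae_of_all _ fun x => hpt y x n) (ae_of_all _ fun x => ?_)
        · exact ((hg.comp (by fun_prop)).mul hk.continuous_transform).aestronglyMeasurable
        · refine Tendsto.mul_const _ ((hg.tendsto _).comp ?_)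
          simpa using (hs.smul_const x).const_sub y
    simp_rw [← hswap, integral_const_mul, integral_mul_const] at hR
    exact tendsto_nhds_unique hL hR
  let d : X →ᵇ ℝ := BoundedContinuousFunction.ofNormedAddCommGroup (fun z => f z / c)
    (hfcont.div_const c) ((∫ ξ, ‖Φ ξ‖ ∂ν) / c) fun z => by
      rw [norm_div, Real.norm_of_nonneg hc0.le]
      exact div_le_div_of_nonneg_right (hfbound z) hc0.le
  have hd0 : ∀ z, 0 ≤ d z := fun z => div_nonneg (hf0 z) hc0.le
  have heq : μ = ν.withDensity fun x => ENNReal.ofReal (d x) := by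
    have : IsLocallyFiniteMeasure (ν.withDensity fun x => ENNReal.ofReal (d x)) :=
      IsLocallyFiniteMeasure.withDensity_ofReal d.continuous
    refine Measure.ext_of_integral_eq_on_compactlySupported fun g => ?_
    rw [integral_withDensity_eq_integral_toReal_smul (by fun_prop) (by simp)]
    have : ∀ x, (ENNReal.ofReal (d x)).toReal • g x = (g x * f x) / c := fun x => by
      rw [ENNReal.toReal_ofReal (hd0 x), smul_eq_mul]
      change f x / c * g x = _
      ring
    simp_rw [this]
    rw [integral_div, key g g.continuous g.hasCompactSupport, mul_div_assoc, div_self hc0.ne',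
      mul_one]
  refine ⟨?_, d, hd0, heq⟩
  rw [heq]
  exact withDensity_absolutelyContinuous _ _

end Density

/-! ### Adjoint contractions and closed subgroups of the dual. -/

lemma tendsto_zero_of_forall_apply {K V : Type*} [NontriviallyNormedField K] [CompleteSpace K]
    [NormedAddCommGroup V] [NormedSpace K V] [FiniteDimensional K V] {f : ℕ → V →L[K] K}
    (h : ∀ x, Tendsto (fun n => f n x) atTop (𝓝 0)) : Tendsto f atTop (𝓝 0) := by
  let b := Module.finBasis K V
  let Λ : (V →L[K] K) →ₗ[K] (Fin (Module.finrank K V) → K) :=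
    { toFun := fun ξ i => ξ (b i)
      map_add' := fun _ _ => rfl
      map_smul' := fun _ _ => rfl }
  have hinj : Function.Injective Λ := fun ξ η hξ =>
    ContinuousLinearMap.coe_injective (b.ext fun i => congrFun hξ i)
  have hemb := LinearMap.isClosedEmbedding_of_injective (LinearMap.ker_eq_bot.2 hinj)
  rw [hemb.isInducing.tendsto_nhds_iff, tendsto_pi_nhds]
  intro i
  simpa [Λ] using h (b i)

lemma iterate_comp_apply {K V : Type*} [NontriviallyNormedField K] [NormedAddCommGroup V]
    [NormedSpace K V] (T : V →L[K] V) (ξ : V →L[K] K) (n : ℕ) (x : V) :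
    (fun η : V →L[K] K => η.comp T)^[n] ξ x = ξ (T^[n] x) := by
  induction n generalizing x with
  | zero => rfl
  | succ n ih =>
    rw [Function.iterate_succ_apply', Function.iterate_succ_apply]
    exact ih (T x)

lemma tendsto_iterate_comp {K V : Type*} [NontriviallyNormedField K] [CompleteSpace K]
    [NormedAddCommGroup V] [NormedSpace K V] [FiniteDimensional K V] {T : V →L[K] V}
    (hT : ∀ x, Tendsto (fun n : ℕ => T^[n] x) atTop (𝓝 0)) (ξ : V →L[K] K) :
    Tendsto (fun n : ℕ => (fun η : V →L[K] K => η.comp T)^[n] ξ) atTop (𝓝 0) := by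
  refine tendsto_zero_of_forall_apply fun x => ?_
  simp_rw [iterate_comp_apply]
  have := (ξ.continuous.tendsto 0).comp (hT x)
  rw [map_zero] at this
  exact this

/-- A closed subgroup of a finite-dimensional real space that accumulates at `0` contains a
line. -/
lemma exists_line_of_tendsto_zero {E : Type*} [NormedAddCommGroup E] [NormedSpace ℝ E]
    [ProperSpace E] {H : AddSubgroup E} (hH : IsClosed (H : Set E)) {u : ℕ → E}
    (hu : ∀ n, u n ∈ H) (hu0 : ∀ n, u n ≠ 0) (hlim : Tendsto u atTop (𝓝 0)) :
    ∃ η : E, η ≠ 0 ∧ ∀ t : ℝ, t • η ∈ H := by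
  obtain ⟨η, hη, φ, hφ, hφlim⟩ := (isCompact_sphere (0 : E) 1).tendsto_subseq
    (x := fun n => ‖u n‖⁻¹ • u n) fun n => by
      simp [norm_smul, inv_mul_cancel₀ (norm_ne_zero_iff.2 (hu0 n))]
  refine ⟨η, ?_, fun t => ?_⟩
  · rintro rfl
    simp at hη
  have hnorm : Tendsto (fun n => ‖u (φ n)‖) atTop (𝓝 0) := by
    simpa using (hlim.comp hφ.tendsto_atTop).norm
  -- Rounding `t / ‖u‖` down gives integer multiples of `u (φ n)`, hence elements of `H`, that
  -- converge to `t • η`.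
  have hfloor : Tendsto (fun n => ‖u (φ n)‖ * ⌊t / ‖u (φ n)‖⌋) atTop (𝓝 t) := by
    have hlow : Tendsto (fun n => t - ‖u (φ n)‖) atTop (𝓝 t) := by
      simpa using hnorm.const_sub t
    refine tendsto_of_tendsto_of_tendsto_of_le_of_le hlow tendsto_const_nhds (fun n => ?_)
      fun n => ?_
    · have hpos : 0 < ‖u (φ n)‖ := norm_pos_iff.2 (hu0 _)
      have h1 := mul_lt_mul_of_pos_left (Int.lt_floor_add_one (t / ‖u (φ n)‖)) hpos
      rw [mul_div_cancel₀ _ hpos.ne'] at h1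
      simp only
      linarith
    · have hpos : 0 < ‖u (φ n)‖ := norm_pos_iff.2 (hu0 _)
      have h1 := mul_le_mul_of_nonneg_left (Int.floor_le (t / ‖u (φ n)‖)) hpos.le
      rwa [mul_div_cancel₀ _ hpos.ne'] at h1
  refine hH.mem_of_tendsto (hfloor.smul hφlim) (Eventually.of_forall fun n => ?_)
  have hne : ‖u (φ n)‖ ≠ 0 := norm_ne_zero_iff.2 (hu0 _)
  have : (‖u (φ n)‖ * (⌊t / ‖u (φ n)‖⌋ : ℝ)) • ((fun n => ‖u n‖⁻¹ • u n) ∘ φ) n =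
      ⌊t / ‖u (φ n)‖⌋ • u (φ n) := by
    simp only [Function.comp]
    rw [smul_smul, mul_right_comm, mul_inv_cancel₀ hne, one_mul, Int.cast_smul_eq_zsmul]
  rw [this]
  exact H.zsmul_mem (hu _) _

/-- If commuting contractions `A i` of a finite-dimensional `p`-adic space and a closed subgroup
`H` satisfy `ξ ∈ H ↔ ∀ i, A i ξ ∈ H`, then `H` is a linear subspace. -/
lemma mem_of_mem_span_of_contractions {p : ℕ} [Fact p.Prime] {E ι : Type*}
    [NormedAddCommGroup E] [NormedSpace ℚ_[p] E] [FiniteDimensional ℚ_[p] E] [Fintype ι]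
    {H : AddSubgroup E} (hH : IsClosed (H : Set E)) (A : ι → E →ₗ[ℚ_[p]] E)
    (hA : ∀ i ξ, Tendsto (fun n : ℕ => (A i)^[n] ξ) atTop (𝓝 0))
    (hcomm : ∀ i j ξ, A i (A j ξ) = A j (A i ξ))
    (hiff : ∀ ξ, ξ ∈ H ↔ ∀ i, A i ξ ∈ H) {ξ : E}
    (hξ : ξ ∈ Submodule.span ℚ_[p] (H : Set E)) : ξ ∈ H := by
  set S := Submodule.span ℚ_[p] (H : Set E) with hS
  have hp0 : (p : ℚ_[p]) ≠ 0 := by exact_mod_cast (Fact.out : p.Prime).ne_zero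
  -- The natural numbers are dense in `ℤ_p` and `H` is closed, so `H` is a `ℤ_p`-module.
  have hint : ∀ (a : ℚ_[p]), ‖a‖ ≤ 1 → ∀ x ∈ H, a • x ∈ H := by
    intro a ha x hx
    have : ∀ z : ℤ_[p], (z : ℚ_[p]) • x ∈ (H : Set E) := fun z =>
      PadicInt.denseRange_natCast.induction_on z
        (hH.preimage (by fun_prop : Continuous fun z : ℤ_[p] => (z : ℚ_[p]) • x)) fun n => by
          simpa [Nat.cast_smul_eq_nsmul] using H.nsmul_mem hx n
    exact this ⟨a, ha⟩
  have hpt : Tendsto (fun n : ℕ => (p : ℚ_[p]) ^ n) atTop (𝓝 0) :=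
    tendsto_pow_atTop_nhds_zero_of_norm_lt_one Padic.norm_p_lt_one
  have hpn : ∀ N : ℕ, ‖(p : ℚ_[p]) ^ N‖ ≤ 1 := fun N => by
    rw [norm_pow]
    exact pow_le_one₀ (norm_nonneg _) Padic.norm_p_lt_one.le
  have hscale : ∀ x ∈ S, ∃ N : ℕ, (p : ℚ_[p]) ^ N • x ∈ H := by
    intro x hx
    induction hx using Submodule.span_induction with
    | mem x hx => exact ⟨0, by simpa using hx⟩
    | zero => exact ⟨0, by simp⟩
    | add x y _ _ hx hy =>
      obtain ⟨N, hN⟩ := hx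
      obtain ⟨M, hM⟩ := hy
      refine ⟨N + M, ?_⟩
      rw [smul_add]
      refine H.add_mem ?_ ?_
      · rw [add_comm, pow_add, mul_smul]
        exact hint _ (hpn _) _ hN
      · rw [pow_add, mul_smul]
        exact hint _ (hpn _) _ hM
    | smul a x _ hx =>
      obtain ⟨N, hN⟩ := hx
      have h1 : Tendsto (fun n : ℕ => ‖(p : ℚ_[p]) ^ n * a‖) atTop (𝓝 0) := by
        simpa using (hpt.mul_const a).norm
      obtain ⟨M, hM⟩ := (h1.eventually (gt_mem_nhds one_pos)).exists
      refine ⟨M + N, ?_⟩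
      have : (p : ℚ_[p]) ^ (M + N) • a • x = ((p : ℚ_[p]) ^ M * a) • (p : ℚ_[p]) ^ N • x := by
        simp only [smul_smul]
        congr 1
        ring
      rw [this]
      exact hint _ hM.le _ hN
  -- `H` is open in `S`: it contains the `ℤ_p`-lattice spanned by a basis of `S` rescaled into `H`,
  -- and this lattice is a neighbourhood of `0` in `S`.
  have hmem : ∀ u : ℕ → E, (∀ n, u n ∈ S) → Tendsto u atTop (𝓝 0) →
      ∀ᶠ n in atTop, u n ∈ H := by
    intro u hu hlim
    let b := Module.finBasis ℚ_[p] S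
    choose N hN using fun i => hscale (b i) (b i).2
    let v : ℕ → S := fun n => ⟨u n, hu n⟩
    have hv : Tendsto v atTop (𝓝 0) := by
      rw [tendsto_subtype_rng]; simpa using hlim
    have hcoord : ∀ i, ∀ᶠ n in atTop, ‖((p : ℚ_[p]) ^ N i)⁻¹ * b.repr (v n) i‖ ≤ 1 := by
      intro i
      have h1 : Tendsto (fun n => b.equivFunL (v n) i) atTop (𝓝 0) := by
        have := (b.equivFunL.continuous.tendsto 0).comp hv
        rw [map_zero] at this
        exact tendsto_pi_nhds.1 this i
      have h2 : Tendsto (fun n => ‖((p : ℚ_[p]) ^ N i)⁻¹ * b.equivFunL (v n) i‖) atTop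
          (𝓝 0) := by
        simpa using (h1.const_mul ((p : ℚ_[p]) ^ N i)⁻¹).norm
      filter_upwards [h2.eventually (gt_mem_nhds one_pos)] with n hn using hn.le
    filter_upwards [eventually_all.2 hcoord] with n hn
    have hsum : u n = ∑ i, (((p : ℚ_[p]) ^ N i)⁻¹ * b.repr (v n) i) •
        ((p : ℚ_[p]) ^ N i • (b i : E)) := by
      have h1 := congrArg (Subtype.val) (b.sum_repr (v n))
      rw [Submodule.coe_sum] at h1
      change _ = u n at h1
      rw [← h1]
      refine Finset.sum_congr rfl fun i _ => ?_
      rw [smul_smul, mul_right_comm, inv_mul_cancel₀ (pow_ne_zero _ hp0), one_mul]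
      rfl
    rw [hsum]
    exact H.sum_mem fun i _ => hint _ (hn i) _ (hN i)
  have hAH : ∀ i x, x ∈ H → A i x ∈ H := fun i x hx => (hiff x).1 hx i
  have hAS : ∀ i x, x ∈ S → A i x ∈ S := by
    intro i x hx
    have : S ≤ S.comap (A i) :=
      Submodule.span_le.2 fun y hy => Submodule.subset_span (hAH i y hy)
    exact this hx
  have hAHn : ∀ i (n : ℕ) x, x ∈ H → (A i)^[n] x ∈ H := fun i n =>
    n.rec (fun x hx => hx) fun n ih x hx => ih _ (hAH i x hx)
  have hASn : ∀ i (n : ℕ) x, x ∈ S → (A i)^[n] x ∈ S := fun i n =>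
    n.rec (fun x hx => hx) fun n ih x hx => ih _ (hAS i x hx)
  by_contra hξH
  classical
  -- For each new index `i`, replace `x` by its last `A i`-iterate outside `H`. The conditions
  -- already gained survive because the maps commute and preserve `H`. With all indices treated, the
  -- equivalence `hiff` is contradicted.
  have push : ∀ s : Finset ι, ∃ x ∈ S, x ∉ H ∧ ∀ j ∈ s, A j x ∈ H := by
    intro s
    induction s using Finset.induction_on with
    | empty => exact ⟨ξ, hξ, hξH, by simp⟩
    | insert i s _ ih =>
      obtain ⟨x, hxS, hxH, hx⟩ := ih
      have hex : ∃ n : ℕ, (A i)^[n] x ∈ H :=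
        (hmem _ (fun n => hASn i n x hxS) (hA i x)).exists
      have hne : Nat.find hex ≠ 0 := fun h0 => hxH (by simpa [h0] using Nat.find_spec hex)
      obtain ⟨k, hk⟩ := Nat.exists_eq_succ_of_ne_zero hne
      refine ⟨(A i)^[k] x, hASn i k x hxS, Nat.find_min hex (by omega), fun j hj => ?_⟩
      rcases Finset.mem_insert.1 hj with rfl | hj
      · have := Nat.find_spec hex
        rwa [hk, Function.iterate_succ_apply'] at this
      · have hc : Function.Commute (A j) (A i) := fun y => hcomm j i y
        rw [(hc.iterate_right k).eq x]
        exact hAHn i k _ (hx j hj)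
  obtain ⟨x, -, hxH, hx⟩ := push Finset.univ
  exact hxH ((hiff x).2 fun i => hx i (Finset.mem_univ i))

/-- A product of numbers in `[0, 1]` equals `1` only if every factor does. -/
lemma mem_phaseSubgroup_iff_forall_comp {K X : Type*} [NontriviallyNormedField K]
    [NormedAddCommGroup X] [NormedSpace K X] [MeasurableSpace X] {ψ : AddChar K Circle}
    {μ : Measure X} [IsProbabilityMeasure μ] {m : ℕ} {T : Fin m → X ≃L[K] X}
    (hprod : ∀ ξ : X →L[K] K, ‖dualCharFun ψ μ ξ‖ =
      ∏ i, ‖dualCharFun ψ μ (ξ.comp (T i : X →L[K] X))‖) (ξ : X →L[K] K) :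
    ξ ∈ phaseSubgroup ψ μ ↔ ∀ i, ξ.comp (T i : X →L[K] X) ∈ phaseSubgroup ψ μ := by
  simp_rw [mem_phaseSubgroup_iff, hprod ξ]
  constructor
  · intro h i
    refine le_antisymm (norm_dualCharFun_le_one _) ?_
    rw [← h, ← Finset.mul_prod_erase _ _ (Finset.mem_univ i)]
    exact mul_le_of_le_one_right (norm_nonneg _)
      (Finset.prod_le_one (fun _ _ => norm_nonneg _) fun _ _ => norm_dualCharFun_le_one _)
  · intro h
    exact Finset.prod_eq_one fun i _ => h i

/-! ### Integrability of the transform, and triviality of the phase subgroup over each field. -/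

section Assembly

variable {K X : Type*} [NontriviallyNormedField K] [ProperSpace K] [NormedAddCommGroup X]
  [NormedSpace K X] [FiniteDimensional K X] [MeasurableSpace X] [BorelSpace X]
  [SecondCountableTopology X] {ψ : AddChar K Circle} {μ : Measure X} [IsProbabilityMeasure μ]
  {m : ℕ} {T : Fin m → X ≃L[K] X}

/-- If no nonzero functional has almost everywhere constant phase, then the Fourier transform of
a solution of the convolution equation is integrable. -/
lemma integrable_dualCharFun (hψ : Continuous ψ) (L : X ≃L[K] (X →L[K] K)) (ν : Measure X)
    [ν.IsAddHaarMeasure]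
    (hT : ∀ i x, Tendsto (fun n : ℕ => (T i)^[n] x) atTop (𝓝 0))
    (hprod : ∀ ξ : X →L[K] K, ‖dualCharFun ψ μ ξ‖ =
      ∏ i, ‖dualCharFun ψ μ (ξ.comp (T i : X →L[K] X))‖)
    (hphase : ∀ ξ ∈ phaseSubgroup ψ μ, ξ = 0) :
    Integrable (fun ξ => dualCharFun ψ μ (L ξ)) ν := by
  have : ProperSpace X := FiniteDimensional.proper K X
  have : ProperSpace (X →L[K] K) := FiniteDimensional.proper K _
  have hcont : Continuous fun ξ => dualCharFun ψ μ (L ξ) :=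
    (continuous_dualCharFun hψ).comp L.continuous
  have hle : ∀ ξ, ‖dualCharFun ψ μ (L ξ)‖ ≤ 1 := fun ξ => norm_dualCharFun_le_one _
  have hlt : ∀ ξ : X →L[K] K, ξ ≠ 0 → ‖dualCharFun ψ μ ξ‖ < 1 := fun ξ hξ =>
    lt_of_le_of_ne (norm_dualCharFun_le_one ξ) fun h =>
      hξ (hphase ξ ((mem_phaseSubgroup_iff ξ).2 h))
  -- Fewer than two factors give no decay. The modulus is then identically `1`, as an empty product
  -- or by invariance along an orbit tending to `0`, so `hphase` makes the dual, and hence `X`,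
  -- zero.
  rcases lt_or_ge m 2 with hm | hm
  · have hall : ∀ ξ : X →L[K] K, ‖dualCharFun ψ μ ξ‖ = 1 := by
      intro ξ
      interval_cases m
      · simpa using hprod ξ
      · have hinv : ∀ n : ℕ, ‖dualCharFun ψ μ ((fun η : X →L[K] K =>
            η.comp (T 0 : X →L[K] X))^[n] ξ)‖ = ‖dualCharFun ψ μ ξ‖ := by
          intro n
          induction n with
          | zero => rfl
          | succ n ih =>
            rw [Function.iterate_succ_apply', ← ih, hprod (_^[n] ξ)]
            simp
        have hlim := ((continuous_dualCharFun (μ := μ) hψ).norm.tendsto 0).comp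
          (tendsto_iterate_comp (T := (T 0 : X →L[K] X)) (hT 0) ξ)
        have h0 : ‖dualCharFun ψ μ (0 : X →L[K] K)‖ = 1 := by simp [dualCharFun]
        rw [h0] at hlim
        exact tendsto_nhds_unique (tendsto_const_nhds.congr fun n => (hinv n).symm) hlim
    have hsub : Subsingleton X := by
      refine ⟨fun x y => L.injective ?_⟩
      rw [hphase (L x) ((mem_phaseSubgroup_iff _).2 (hall _)),
        hphase (L y) ((mem_phaseSubgroup_iff _).2 (hall _))]
    have : IsFiniteMeasure ν := ⟨isCompact_univ.measure_lt_top⟩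
    exact Integrable.of_bound hcont.aestronglyMeasurable 1 (ae_of_all _ hle)
  · let A : Fin m → X → X := fun i ξ => L.symm ((L ξ).comp (T i : X →L[K] X))
    let i₀ : Fin m := ⟨0, by omega⟩
    let i₁ : Fin m := ⟨1, by omega⟩
    let R : Fin m → ℝ := fun i => ‖(L.symm : (X →L[K] K) →L[K] X)‖ *
      (‖(L : X →L[K] (X →L[K] K))‖ * ‖((T i).symm : X →L[K] X)‖)
    -- One scalar serves twice: `‖t‖` bounds the shrinking by both adjoints, and `t` is the
    -- homothety that compares volumes of balls.
    obtain ⟨t, ht⟩ := NormedField.exists_lt_norm K (max 1 (max (R i₀) (R i₁)))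
    have ht1 : 1 < ‖t‖ := (le_max_left _ _).trans_lt ht
    have hexp : ∀ i, ∀ ξ, ‖ξ‖ ≤ R i * ‖A i ξ‖ := by
      intro i ξ
      have h1 : L ξ = (L (A i ξ)).comp ((T i).symm : X →L[K] X) := by
        ext x
        simp [A]
      calc ‖ξ‖ = ‖L.symm (L ξ)‖ := by simp
        _ ≤ ‖(L.symm : (X →L[K] K) →L[K] X)‖ * ‖L ξ‖ :=
          (L.symm : (X →L[K] K) →L[K] X).le_opNorm _
        _ ≤ ‖(L.symm : (X →L[K] K) →L[K] X)‖ *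
            (‖L (A i ξ)‖ * ‖((T i).symm : X →L[K] X)‖) := by
          gcongr
          rw [h1]
          exact ContinuousLinearMap.opNorm_comp_le _ _
        _ ≤ ‖(L.symm : (X →L[K] K) →L[K] X)‖ *
            ((‖(L : X →L[K] (X →L[K] K))‖ * ‖A i ξ‖) * ‖((T i).symm : X →L[K] X)‖) := by
          gcongr
          exact (L : X →L[K] (X →L[K] K)).le_opNorm _
        _ = R i * ‖A i ξ‖ := by simp only [R]; ring
    have hiter : ∀ (n : ℕ) ξ, (A i₀)^[n] ξ =
        L.symm ((fun η : X →L[K] K => η.comp (T i₀ : X →L[K] X))^[n] (L ξ)) := by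
      intro n ξ
      induction n with
      | zero => simp
      | succ n ih => simp only [Function.iterate_succ_apply', ih, A, L.apply_symm_apply]
    obtain ⟨θ, hθ0, hθ1, hθ⟩ := exists_superpolynomial_decay (A := A i₀) (B := A i₁)
      (Φ := fun ξ => ‖dualCharFun ψ μ (L ξ)‖) (C := ‖t‖) hcont.norm (fun _ => norm_nonneg _) hle
      (fun ξ hξ => hlt _ fun h => hξ (by simpa using h)) ht1.le
      (fun ξ => (hexp i₀ ξ).trans (mul_le_mul_of_nonneg_right
        (((le_max_left _ _).trans (le_max_right _ _)).trans ht.le) (norm_nonneg _)))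
      (fun ξ => (hexp i₁ ξ).trans (mul_le_mul_of_nonneg_right
        (((le_max_right _ _).trans (le_max_right _ _)).trans ht.le) (norm_nonneg _)))
      (fun ξ => by
        simp_rw [hiter]
        have := (L.symm.continuous.tendsto 0).comp
          (tendsto_iterate_comp (T := (T i₀ : X →L[K] X)) (hT i₀) (L ξ))
        rw [map_zero] at this
        exact this)
      (fun ξ => by
        have hne : i₁ ≠ i₀ := by simp [i₀, i₁]
        simp only [A, L.apply_symm_apply]
        rw [hprod (L ξ), ← Finset.mul_prod_erase _ _ (Finset.mem_univ i₀),
          ← Finset.mul_prod_erase _ _ (Finset.mem_erase.2 ⟨hne, Finset.mem_univ i₁⟩)]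
        refine mul_le_mul_of_nonneg_left (mul_le_of_le_one_right (norm_nonneg _) ?_)
          (norm_nonneg _)
        exact Finset.prod_le_one (fun _ _ => norm_nonneg _) fun _ _ => norm_dualCharFun_le_one _)
    exact integrable_of_superpolynomial_decay ν hcont hle ht1 hθ0 hθ1 hθ

end Assembly

/-- In the real case no nonzero functional has almost everywhere constant phase. -/
lemma real_eq_zero_of_mem_phaseSubgroup {X : Type*} [NormedAddCommGroup X] [NormedSpace ℝ X]
    [FiniteDimensional ℝ X] [MeasurableSpace X] [BorelSpace X] {ψ : AddChar ℝ Circle}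
    {μ : Measure X} [IsProbabilityMeasure μ] {m : ℕ} {T : Fin m → X ≃L[ℝ] X}
    (hψ : Continuous ψ) (hψ1 : ψ ≠ 1) (hμ : IsFull ℝ μ)
    (hT : ∀ i x, Tendsto (fun n : ℕ => (T i)^[n] x) atTop (𝓝 0))
    (hprod : ∀ ξ : X →L[ℝ] ℝ, ‖dualCharFun ψ μ ξ‖ =
      ∏ i, ‖dualCharFun ψ μ (ξ.comp (T i : X →L[ℝ] X))‖)
    {ξ : X →L[ℝ] ℝ} (hξ : ξ ∈ phaseSubgroup ψ μ) : ξ = 0 := by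
  have : ProperSpace X := FiniteDimensional.proper ℝ X
  have : ProperSpace (X →L[ℝ] ℝ) := FiniteDimensional.proper ℝ _
  have hiff := mem_phaseSubgroup_iff_forall_comp hprod
  by_contra hne
  rcases Nat.eq_zero_or_pos m with rfl | hm
  -- For `m = 0` the condition on the `T i` is empty, so every functional lies in the phase
  -- subgroup.
  · exact hne (eq_zero_of_forall_smul_mem_phaseSubgroup hψ hψ1 hμ
      fun t => (hiff _).2 fun i => i.elim0)
  · let A : (X →L[ℝ] ℝ) → X →L[ℝ] ℝ := fun η => η.comp (T ⟨0, hm⟩ : X →L[ℝ] X)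
    have hA0 : ∀ η, η ≠ 0 → A η ≠ 0 := by
      intro η hη h
      refine hη (ContinuousLinearMap.ext fun x => ?_)
      simpa [A] using congrArg (fun ζ : X →L[ℝ] ℝ => ζ ((T ⟨0, hm⟩).symm x)) h
    have hmem : ∀ n : ℕ, A^[n] ξ ∈ phaseSubgroup ψ μ ∧ A^[n] ξ ≠ 0 := by
      intro n
      induction n with
      | zero => exact ⟨hξ, hne⟩
      | succ n ih =>
        rw [Function.iterate_succ_apply']
        exact ⟨(hiff _).1 ih.1 _, hA0 _ ih.2⟩
    obtain ⟨η, hη, hline⟩ := exists_line_of_tendsto_zero (isClosed_phaseSubgroup hψ)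
      (fun n => (hmem n).1) (fun n => (hmem n).2)
      (tendsto_iterate_comp (T := (T ⟨0, hm⟩ : X →L[ℝ] X)) (hT _) ξ)
    exact hη (eq_zero_of_forall_smul_mem_phaseSubgroup hψ hψ1 hμ hline)

/-- In the `p`-adic case no nonzero functional has almost everywhere constant phase. -/
lemma padic_eq_zero_of_mem_phaseSubgroup {p : ℕ} [Fact p.Prime] {X : Type*}
    [NormedAddCommGroup X] [NormedSpace ℚ_[p] X] [FiniteDimensional ℚ_[p] X] [MeasurableSpace X]
    [BorelSpace X] {ψ : AddChar ℚ_[p] Circle} {μ : Measure X} [IsProbabilityMeasure μ] {m : ℕ}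
    {T : Fin m → X ≃L[ℚ_[p]] X}
    (hψ : Continuous ψ) (hψ1 : ψ ≠ 1) (hμ : IsFull ℚ_[p] μ)
    (hT : ∀ i x, Tendsto (fun n : ℕ => (T i)^[n] x) atTop (𝓝 0))
    (hcomm : ∀ i j, Function.Commute (T i) (T j))
    (hprod : ∀ ξ : X →L[ℚ_[p]] ℚ_[p], ‖dualCharFun ψ μ ξ‖ =
      ∏ i, ‖dualCharFun ψ μ (ξ.comp (T i : X →L[ℚ_[p]] X))‖)
    {ξ : X →L[ℚ_[p]] ℚ_[p]} (hξ : ξ ∈ phaseSubgroup ψ μ) : ξ = 0 := by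
  have : ProperSpace X := FiniteDimensional.proper ℚ_[p] X
  refine eq_zero_of_forall_smul_mem_phaseSubgroup hψ hψ1 hμ fun t => ?_
  let A : Fin m → (X →L[ℚ_[p]] ℚ_[p]) →ₗ[ℚ_[p]] (X →L[ℚ_[p]] ℚ_[p]) := fun i =>
    { toFun := fun η => η.comp (T i : X →L[ℚ_[p]] X)
      map_add' := fun _ _ => rfl
      map_smul' := fun _ _ => rfl }
  refine mem_of_mem_span_of_contractions (isClosed_phaseSubgroup hψ) A
    (fun i η => tendsto_iterate_comp (T := (T i : X →L[ℚ_[p]] X)) (hT i) η) (fun i j η => ?_)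
    (mem_phaseSubgroup_iff_forall_comp hprod)
    (Submodule.smul_mem _ _ (Submodule.subset_span hξ))
  ext x
  exact congrArg η (hcomm j i x)

/-! ### Characters and summability kernels over `ℝ` and `ℚ_p`. -/

/-- The self-duality of `Fin d → K` given by the dot product. -/
noncomputable def dotProductDual (K : Type*) [NontriviallyNormedField K] [CompleteSpace K]
    (d : ℕ) : (Fin d → K) ≃L[K] ((Fin d → K) →L[K] K) :=
  ((dotProductEquiv K (Fin d)).trans LinearMap.toContinuousLinearMap).toContinuousLinearEquiv

lemma dotProductDual_apply {K : Type*} [NontriviallyNormedField K] [CompleteSpace K]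
    {d : ℕ} (ξ x : Fin d → K) : dotProductDual K d ξ x = ∑ i, ξ i * x i := rfl

/-- The Gaussian is a summability kernel. -/
lemma isSummabilityKernel_gaussian (d : ℕ) :
    IsSummabilityKernel Real.fourierChar (dotProductDual ℝ d) volume
      (fun ξ => Real.exp (-∑ i, ξ i ^ 2))
      (fun x => Real.pi ^ (d / 2 : ℝ) * Real.exp (-(Real.pi ^ 2 * ∑ i, x i ^ 2))) := by
  have hint : ∀ b : ℝ, 0 < b →
      Integrable fun x : Fin d → ℝ => Real.exp (-(b * ∑ i, x i ^ 2)) := by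
    intro b hb
    have := (GaussianFourier.integrable_cexp_neg_mul_sum_add (b := (b : ℂ)) (ι := Fin d)
      (by simpa using hb) 0).re
    refine this.congr (ae_of_all _ fun x => ?_)
    have : (-(b : ℂ) * ∑ i, (x i : ℂ) ^ 2 + ∑ i, (0 : Fin d → ℂ) i * x i) =
        ((-(b * ∑ i, x i ^ 2) : ℝ) : ℂ) := by
      push_cast; simp
    simp only [this]
    exact Complex.exp_ofReal_re _
  have hpi : (0 : ℝ) < Real.pi ^ (d / 2 : ℝ) := Real.rpow_pos_of_pos Real.pi_pos _
  refine ⟨by simpa using hint 1 one_pos, fun ξ => ?_, (by fun_prop : Continuous _).continuousAt,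
    by simp, by fun_prop,
    fun x => by positivity, (hint _ (by positivity)).const_mul _, ?_, fun x => ?_⟩
  · rw [Real.norm_of_nonneg (Real.exp_pos _).le, Real.exp_le_one_iff, neg_nonpos]
    positivity
  · rw [integral_const_mul]
    exact mul_pos hpi (integral_exp_pos (hint _ (by positivity)))
  · have h := GaussianFourier.integral_cexp_neg_mul_sum_add (b := (1 : ℂ)) (ι := Fin d)
      (by simp) fun i => 2 * Real.pi * Complex.I * x i
    have h1 : ∀ ξ : Fin d → ℝ, ((Real.exp (-∑ i, ξ i ^ 2) : ℝ) : ℂ) *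
        (Real.fourierChar (dotProductDual ℝ d ξ x) : ℂ) =
        Complex.exp (-1 * ∑ i, (ξ i : ℂ) ^ 2 +
          ∑ i, (2 * Real.pi * Complex.I * x i) * (ξ i : ℂ)) := by
      intro ξ
      rw [Real.fourierChar_apply, Complex.ofReal_exp, ← Complex.exp_add, dotProductDual_apply]
      congr 1
      push_cast
      rw [neg_one_mul, Finset.mul_sum, Finset.sum_mul]
      congr 1
      exact Finset.sum_congr rfl fun i _ => by ring
    simp_rw [h1]
    rw [h]
    have h2 : ((∑ i, (2 * Real.pi * Complex.I * x i) ^ 2) / (4 * 1) : ℂ) =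
        ((-(Real.pi ^ 2 * ∑ i, x i ^ 2) : ℝ) : ℂ) := by
      push_cast
      rw [Finset.mul_sum, ← Finset.sum_neg_distrib, Finset.sum_div]
      refine Finset.sum_congr rfl fun i _ => ?_
      rw [mul_pow, mul_pow, mul_pow, Complex.I_sq]
      ring
    rw [h2, Complex.ofReal_mul, Complex.ofReal_exp, Complex.ofReal_cpow Real.pi_pos.le]
    simp

lemma fourierChar_ne_one : Real.fourierChar ≠ 1 := by
  intro h
  have h1 := congrArg (fun z : Circle => (z : ℂ)) (AddChar.eq_one_iff.1 h (1 / 2))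
  simp only [Real.fourierChar_apply, Circle.coe_one] at h1
  have h2 : ((2 * Real.pi * (1 / 2) : ℝ) : ℂ) * Complex.I = Real.pi * Complex.I := by
    push_cast; ring
  rw [h2, Complex.exp_pi_mul_I] at h1
  norm_num at h1

/-- There is a character of `ℚ_p` that is trivial on `ℤ_p` but not at `1 / p`. -/
lemma exists_padic_addChar (p : ℕ) [Fact p.Prime] :
    ∃ ψ : AddChar ℚ_[p] Circle, (∀ x, ‖x‖ ≤ 1 → ψ x = 1) ∧ ψ ((p : ℚ_[p])⁻¹) ≠ 1 := by
  let Z : AddSubgroup ℚ_[p] := (PadicInt.subring p).toAddSubgroup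
  have hZ : ∀ x : ℚ_[p], x ∈ Z ↔ ‖x‖ ≤ 1 := fun x => Iff.rfl
  have hp : ((QuotientAddGroup.mk ((p : ℚ_[p])⁻¹) : ℚ_[p] ⧸ Z)) ≠ 0 := by
    rw [Ne, QuotientAddGroup.eq_zero_iff, hZ, not_le, norm_inv]
    exact (one_lt_inv₀ (norm_pos_iff.2 (by exact_mod_cast (Fact.out : p.Prime).ne_zero))).2
      Padic.norm_p_lt_one
  -- Characters into `ℚ/ℤ` separate points of the abelian group `ℚ_p/ℤ_p`; composing with the
  -- injection `r` of `ℚ/ℤ` into the circle loses nothing.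
  obtain ⟨χ, hχ⟩ := CharacterModule.exists_character_apply_ne_zero_of_ne_zero hp
  let r₀ : ℚ →+ Additive Circle :=
    { toFun := fun q => Additive.ofMul (AddCircle.toCircle ((q : ℝ) : AddCircle (1 : ℝ)))
      map_zero' := by simp
      map_add' := fun a b => by
        rw [Rat.cast_add, AddCircle.coe_add, AddCircle.toCircle_add]; rfl }
  have hr₀ : ∀ q : ℚ, r₀ q = 0 ↔ ∃ n : ℤ, n • (1 : ℚ) = q := by
    intro q
    have h1 : r₀ q = 0 ↔ AddCircle.toCircle ((q : ℝ) : AddCircle (1 : ℝ)) =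
        AddCircle.toCircle (0 : AddCircle (1 : ℝ)) := by
      rw [AddCircle.toCircle_zero]; exact Iff.rfl
    rw [h1, (AddCircle.injective_toCircle one_ne_zero).eq_iff, AddCircle.coe_eq_zero_iff]
    refine exists_congr fun n => ?_
    simp only [zsmul_eq_mul, mul_one]
    exact_mod_cast Iff.rfl
  let r : AddCircle (1 : ℚ) →+ Additive Circle :=
    QuotientAddGroup.lift (AddSubgroup.zmultiples (1 : ℚ)) r₀ fun q hq =>
      (hr₀ q).2 (AddSubgroup.mem_zmultiples_iff.1 hq)
  have hr : ∀ a, r a = 0 → a = 0 := by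
    intro a
    induction a using QuotientAddGroup.induction_on with
    | H q => exact fun h => (AddCircle.coe_eq_zero_iff _).2 ((hr₀ q).1 h)
  let χ' : ℚ_[p] ⧸ Z →+ AddCircle (1 : ℚ) := χ
  let ψ : AddChar ℚ_[p] Circle :=
    AddChar.toAddMonoidHomEquiv.symm ((r.comp χ').comp (QuotientAddGroup.mk' Z))
  have hψ : ∀ x, ψ x = 1 ↔ r (χ' (QuotientAddGroup.mk' Z x)) = 0 := fun x => Iff.rfl
  refine ⟨ψ, fun x hx => (hψ x).2 ?_, fun h => hχ (hr _ ((hψ _).1 h))⟩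
  rw [show QuotientAddGroup.mk' Z x = 0 from (QuotientAddGroup.eq_zero_iff x).2 ((hZ x).2 hx)]
  simp

section Padic

variable {p : ℕ} [Fact p.Prime] {ψ : AddChar ℚ_[p] Circle}

/-- Triviality on the unit ball makes the character locally constant. -/
lemma continuous_padic_addChar (h1 : ∀ x, ‖x‖ ≤ 1 → ψ x = 1) : Continuous ψ := by
  refine continuous_iff_continuousAt.2 fun x => ?_
  refine (continuousAt_const (y := ψ x)).congr ?_
  filter_upwards [Metric.closedBall_mem_nhds x one_pos] with y hy
  have h2 : ‖y - x‖ ≤ 1 := by simpa [dist_eq_norm] using hy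
  have h3 := AddChar.map_add_eq_mul ψ (y - x) x
  rw [sub_add_cancel, h1 _ h2, one_mul] at h3
  exact h3.symm

/-- The indicator of the unit ball is a summability kernel. -/
lemma isSummabilityKernel_ball (h1 : ∀ x, ‖x‖ ≤ 1 → ψ x = 1) (hp : ψ ((p : ℚ_[p])⁻¹) ≠ 1)
    (d : ℕ) [MeasurableSpace (Fin d → ℚ_[p])] [BorelSpace (Fin d → ℚ_[p])]
    (ν : Measure (Fin d → ℚ_[p])) [ν.IsAddHaarMeasure] :
    IsSummabilityKernel ψ (dotProductDual ℚ_[p] d) ν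
      ((Metric.closedBall 0 1).indicator 1)
      (fun x => ν.real (Metric.closedBall 0 1) * (Metric.closedBall 0 1).indicator 1 x) := by
  set B : Set (Fin d → ℚ_[p]) := Metric.closedBall 0 1 with hB
  have hclopen : IsClopen B := IsUltrametricDist.isClopen_closedBall _ one_ne_zero
  have hmeas : MeasurableSet B := hclopen.isClosed.measurableSet
  have hfin : ν B < ⊤ := (isCompact_closedBall _ _).measure_lt_top
  have hcont : Continuous (B.indicator (1 : (Fin d → ℚ_[p]) → ℝ)) :=
    continuous_one.indicator fun x hx => by simp [hclopen.frontier_eq] at hx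
  have hint : Integrable (B.indicator (1 : (Fin d → ℚ_[p]) → ℝ)) ν :=
    (integrable_indicator_iff hmeas).2 (integrableOn_const hfin.ne)
  have hpos : 0 < ν.real B :=
    ENNReal.toReal_pos (Metric.measure_closedBall_pos ν _ one_pos).ne' hfin.ne
  have hmem : ∀ x : Fin d → ℚ_[p], x ∈ B ↔ ‖x‖ ≤ 1 := fun x => by simp [hB]
  refine ⟨hint, fun ξ => ?_, hcont.continuousAt, ?_, continuous_const.mul hcont, fun x => ?_,
    hint.const_mul _, ?_, fun x => ?_⟩
  · by_cases hξ : ξ ∈ B <;> simp [hξ]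
  · simp [hB]
  · exact mul_nonneg hpos.le (Set.indicator_nonneg (fun _ _ => zero_le_one) _)
  · rw [integral_const_mul, integral_indicator_one hmeas]
    exact mul_pos hpos hpos
  by_cases hx : x ∈ B
  · have h2 : ∀ ξ, ((B.indicator 1 ξ : ℝ) : ℂ) * (ψ (dotProductDual ℚ_[p] d ξ x) : ℂ) =
        ((B.indicator 1 ξ : ℝ) : ℂ) := by
      intro ξ
      by_cases hξ : ξ ∈ B
      · rw [h1, Circle.coe_one, mul_one]
        rw [dotProductDual_apply]
        refine IsUltrametricDist.norm_sum_le_of_forall_le_of_nonneg zero_le_one fun i _ => ?_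
        rw [norm_mul]
        exact mul_le_one₀ ((norm_le_pi_norm ξ i).trans ((hmem ξ).1 hξ)) (norm_nonneg _)
          ((norm_le_pi_norm x i).trans ((hmem x).1 hx))
      · simp [hξ]
    simp_rw [h2]
    rw [integral_complex_ofReal, integral_indicator_one hmeas]
    simp [hx]
  · obtain ⟨i, hi⟩ : ∃ i, 1 < ‖x i‖ := by
      by_contra! h
      exact hx ((hmem x).2 ((pi_norm_le_iff_of_nonneg zero_le_one).2 h))
    have hp0 : (p : ℚ_[p]) ≠ 0 := by exact_mod_cast (Fact.out : p.Prime).ne_zero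
    have hxi : x i ≠ 0 := norm_pos_iff.1 (by linarith)
    -- The `p`-adic norm takes only powers of `p` as nonzero values, so `1 < ‖x i‖` already gives `p
    -- ≤ ‖x i‖`.
    have hpn : ‖((p : ℚ_[p]) * x i)⁻¹‖ ≤ 1 := by
      have h2 : ‖(x i)⁻¹‖ < 1 := by
        rw [norm_inv]; exact inv_lt_one_of_one_lt₀ hi
      have h3 := (Padic.norm_lt_pow_iff_norm_le_pow_sub_one (x i)⁻¹ 0).1 (by simpa using h2)
      rw [mul_inv, norm_mul, norm_inv, Padic.norm_p, inv_inv]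
      calc (p : ℝ) * ‖(x i)⁻¹‖ ≤ p * (p : ℝ) ^ ((0 : ℤ) - 1) := by gcongr
        _ = 1 := by
          have : (p : ℝ) ≠ 0 := by exact_mod_cast (Fact.out : p.Prime).ne_zero
          simp [this]
    -- Orthogonality of characters: translation by `ξ₀` preserves the ball and multiplies the
    -- integrand by `ψ (1 / p) ≠ 1`, so the integral vanishes.
    let ξ₀ : Fin d → ℚ_[p] := Pi.single i ((p : ℚ_[p]) * x i)⁻¹
    have hξ₀ : ‖ξ₀‖ ≤ 1 := by rwa [Pi.norm_single]
    have hdot : dotProductDual ℚ_[p] d ξ₀ x = (p : ℚ_[p])⁻¹ := by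
      rw [dotProductDual_apply, Finset.sum_eq_single i]
      · simp only [ξ₀, Pi.single_eq_same]
        field_simp
      · intro j _ hj
        simp [ξ₀, hj]
      · simp
    have htrans : ∀ ξ, B.indicator (1 : (Fin d → ℚ_[p]) → ℝ) (ξ + ξ₀) = B.indicator 1 ξ := by
      intro ξ
      have : ξ + ξ₀ ∈ B ↔ ξ ∈ B := by
        rw [hmem, hmem]
        constructor
        · intro h
          have := IsUltrametricDist.norm_add_le_max (ξ + ξ₀) (-ξ₀)
          rw [add_neg_cancel_right, norm_neg] at this
          exact this.trans (max_le h hξ₀)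
        · intro h
          exact (IsUltrametricDist.norm_add_le_max ξ ξ₀).trans (max_le h hξ₀)
      by_cases h : ξ ∈ B
      · simp [h, this.2 h]
      · simp [h, mt this.1 h]
    set I := ∫ ξ, ((B.indicator 1 ξ : ℝ) : ℂ) * (ψ (dotProductDual ℚ_[p] d ξ x) : ℂ) ∂ν with hI
    have hinv : I = I * (ψ ((p : ℚ_[p])⁻¹) : ℂ) := by
      conv_lhs => rw [hI, ← integral_add_right_eq_self _ ξ₀]
      rw [hI, ← integral_mul_const]
      refine integral_congr_ae (ae_of_all _ fun ξ => ?_)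
      simp only [htrans, map_add, add_apply, hdot, AddChar.map_add_eq_mul, Circle.coe_mul]
      ring
    have hne : (ψ ((p : ℚ_[p])⁻¹) : ℂ) ≠ 1 := fun h => hp (Circle.coe_eq_one.1 h)
    have hzero : I * ((ψ ((p : ℚ_[p])⁻¹) : ℂ) - 1) = 0 := by
      rw [mul_sub, ← hinv, mul_one, sub_self]
    rcases mul_eq_zero.1 hzero with h | h
    · rw [h]; simp [hx]
    · exact absurd (sub_eq_zero.1 h) hne

end Padic

/-! ### Reduction to coordinates. -/

/-- A continuous additive automorphism is linear if the rationals are dense in the base field. -/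
noncomputable def ContinuousAddEquiv.toCLEOfDenseRange {K V : Type*} [NontriviallyNormedField K]
    [AddCommGroup V] [Module K V] [TopologicalSpace V] [T2Space V] [ContinuousSMul K V]
    (hK : DenseRange ((↑) : ℚ → K)) (T : V ≃ₜ+ V) : V ≃L[K] V where
  toFun := T
  invFun := T.symm
  left_inv := T.left_inv
  right_inv := T.right_inv
  map_add' := map_add T
  map_smul' := fun a x => by
    refine hK.induction_on (p := fun a : K => T (a • x) = a • T x) a
      (isClosed_eq (T.continuous.comp (by fun_prop)) (by fun_prop)) fun q => ?_
    exact map_ratCast_smul T K K q x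
  continuous_toFun := T.continuous
  continuous_invFun := T.symm.continuous

/-- The Fourier transform turns the convolution of a list of measures into a product. -/
lemma integral_foldr_conv {V : Type*} [AddCommGroup V] [TopologicalSpace V] [MeasurableSpace V]
    [BorelSpace V] [MeasurableAdd₂ V] {χ : V → Circle} (hχ : Continuous χ) (hχ0 : χ 0 = 1)
    (hχadd : ∀ x y, χ (x + y) = χ x * χ y) (l : List (Measure V))
    (hl : ∀ ρ ∈ l, IsProbabilityMeasure ρ) :
    IsProbabilityMeasure (l.foldr Measure.conv (Measure.dirac 0)) ∧
    ∫ x, (χ x : ℂ) ∂(l.foldr Measure.conv (Measure.dirac 0)) =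
      (l.map fun ρ => ∫ x, (χ x : ℂ) ∂ρ).prod := by
  have hm : Measurable fun x => (χ x : ℂ) := (continuous_circle_coe.comp hχ).measurable
  induction l with
  | nil =>
    refine ⟨by simpa using Measure.dirac.isProbabilityMeasure, ?_⟩
    simp only [List.foldr_nil, List.map_nil, List.prod_nil]
    rw [integral_dirac' _ _ hm.stronglyMeasurable, hχ0, Circle.coe_one]
  | cons ρ l ih =>
    obtain ⟨h1, h2⟩ := ih fun σ hσ => hl σ (List.mem_cons_of_mem _ hσ)
    have hρ : IsProbabilityMeasure ρ := hl ρ List.mem_cons_self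
    simp only [List.foldr_cons, List.map_cons, List.prod_cons]
    have h3 : IsProbabilityMeasure (Measure.conv ρ (l.foldr Measure.conv (Measure.dirac 0))) :=
      inferInstance
    refine ⟨h3, ?_⟩
    rw [integral_conv (Integrable.of_bound hm.aestronglyMeasurable 1
      (ae_of_all _ fun x => (Circle.norm_coe _).le)), ← h2]
    simp_rw [hχadd, Circle.coe_mul, integral_const_mul, integral_mul_const]

/-- The property of having a bounded continuous density can be checked after a linear change of
coordinates, and for one Haar measure only. -/
lemma HasBoundedContinuousDensity.of_map {K V X : Type*} [NontriviallyNormedField K]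
    [AddCommGroup V] [Module K V] [TopologicalSpace V] [IsTopologicalAddGroup V]
    [MeasurableSpace V] [BorelSpace V]
    [NormedAddCommGroup X] [NormedSpace K X] [ProperSpace X] [MeasurableSpace X] [BorelSpace X]
    [SecondCountableTopology X] (e : V ≃L[K] X) {haar μ : Measure V} [haar.IsAddHaarMeasure]
    {ν : Measure X} [ν.IsAddHaarMeasure] (h : HasBoundedContinuousDensity (μ.map e) ν) :
    HasBoundedContinuousDensity μ haar := by
  obtain ⟨-, f, hf0, hf⟩ := h
  have hH : (haar.map e).IsAddHaarMeasure := e.isAddHaarMeasure_map haar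
  obtain ⟨c, hc⟩ : ∃ c : NNReal, ν = c • haar.map e :=
    ⟨_, Measure.isAddLeftInvariant_eq_smul ν (haar.map e)⟩
  have he : Measurable e := e.continuous.measurable
  -- By uniqueness of Haar measure `ν` is `c` times the image of `haar`, whence the factor `c` in
  -- the pulled-back density.
  let g : V →ᵇ ℝ := (c : ℝ) • f.compContinuous ⟨e, e.continuous⟩
  have hg : ∀ x, g x = c * f (e x) := fun x => rfl
  have heq : μ = haar.withDensity fun x => ENNReal.ofReal (g x) := by
    ext s hs
    have hs' : MeasurableSet (e.symm ⁻¹' s) := e.symm.continuous.measurable hs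
    have hpre : e ⁻¹' (e.symm ⁻¹' s) = s := by ext; simp
    have h1 := congrArg (fun m => m (e.symm ⁻¹' s)) hf
    rw [Measure.map_apply he hs', hpre, withDensity_apply _ hs', hc] at h1
    rw [h1, withDensity_apply _ hs, Measure.restrict_smul, lintegral_smul_measure,
      setLIntegral_map hs' (by fun_prop) he, hpre]
    simp_rw [hg, ENNReal.ofReal_mul (NNReal.coe_nonneg c), ENNReal.ofReal_coe_nnreal]
    rw [lintegral_const_mul _ (by fun_prop)]
    rfl
  refine ⟨?_, g, fun x => mul_nonneg c.2 (hf0 _), heq⟩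
  rw [heq]
  exact withDensity_absolutelyContinuous _ _

section Coordinates

variable {K V : Type*} [NontriviallyNormedField K] [ProperSpace K] [SecondCountableTopology K]
  [MeasurableSpace K] [BorelSpace K]
  [AddCommGroup V] [Module K V] [FiniteDimensional K V] [TopologicalSpace V] [T2Space V]
  [IsTopologicalAddGroup V] [ContinuousSMul K V] [MeasurableSpace V] [BorelSpace V]

/-- In coordinates, a solution of the convolution equation has a Fourier transform satisfying
the corresponding product formula. -/
lemma exists_coordinates (hK : DenseRange ((↑) : ℚ → K)) {ψ : AddChar K Circle}
    (hψ : Continuous ψ) (μ : Measure V) [IsProbabilityMeasure μ] (hμ : IsFull K μ) {m : ℕ}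
    (T : Fin m → V ≃ₜ+ V) (hT : ∀ i, IsContraction (T i))
    (hcomm : ∀ i j, Function.Commute (T i) (T j)) (hconv : μ = convImages T μ) :
    ∃ (d : ℕ) (e : V ≃L[K] (Fin d → K)) (S : Fin m → (Fin d → K) ≃L[K] (Fin d → K)),
      IsProbabilityMeasure (μ.map e) ∧ IsFull K (μ.map e) ∧
      (∀ i x, Tendsto (fun n : ℕ => (S i)^[n] x) atTop (𝓝 0)) ∧
      (∀ i j, Function.Commute (S i) (S j)) ∧
      ∀ ξ : (Fin d → K) →L[K] K, ‖dualCharFun ψ (μ.map e) ξ‖ =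
        ∏ i, ‖dualCharFun ψ (μ.map e) (ξ.comp (S i : (Fin d → K) →L[K] (Fin d → K)))‖ := by
  let e : V ≃L[K] (Fin (Module.finrank K V) → K) := (Module.finBasis K V).equivFunL
  have : SecondCountableTopology V := e.toHomeomorph.secondCountableTopology
  have he : Measurable e := e.continuous.measurable
  let S : Fin m → (Fin (Module.finrank K V) → K) ≃L[K] (Fin (Module.finrank K V) → K) := fun i =>
    (e.symm.trans ((T i).toCLEOfDenseRange hK)).trans e
  have hS : ∀ i x, S i x = e (T i (e.symm x)) := fun i x => rfl
  have hSn : ∀ i (n : ℕ) x, (S i)^[n] x = e ((T i)^[n] (e.symm x)) := by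
    intro i n x
    induction n with
    | zero => simp
    | succ n ih => simp only [Function.iterate_succ_apply', ih, hS, e.symm_apply_apply]
  have hprob : IsProbabilityMeasure (μ.map e) :=
    Measure.isProbabilityMeasure_map he.aemeasurable
  refine ⟨_, e, S, hprob, ?_, fun i x => ?_, fun i j x => ?_, fun ξ => ?_⟩
  · intro W hW x h
    have hWc : IsClosed (W : Set (Fin (Module.finrank K V) → K)) := W.closed_of_finiteDimensional
    have hm : MeasurableSet {y | y - x ∈ W}ᶜ :=
      (hWc.preimage (by fun_prop : Continuous fun y => y - x)).measurableSet.compl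
    rw [Measure.map_apply he hm] at h
    refine hμ (W.comap (e : V →ₗ[K] (Fin (Module.finrank K V) → K))) (fun htop => hW ?_)
      (e.symm x) ?_
    · rw [eq_top_iff]
      intro y _
      have : e.symm y ∈ W.comap (e : V →ₗ[K] (Fin (Module.finrank K V) → K)) := by
        rw [htop]; trivial
      simpa using this
    · convert h using 2
      ext y
      simp
  · simp_rw [hSn]
    have := (e.continuous.tendsto 0).comp (hT i (e.symm x))
    rw [map_zero] at this
    exact this
  · simp only [hS, e.symm_apply_apply]
    rw [(hcomm i j).eq]
  · have hξ : Continuous fun v => ψ (ξ (e v)) := by fun_prop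
    have hsm : ∀ η : (Fin (Module.finrank K V) → K) →L[K] K,
        dualCharFun ψ (μ.map e) η = ∫ v, (ψ (η (e v)) : ℂ) ∂μ := fun η =>
      integral_map he.aemeasurable (continuous_character_apply hψ η).aestronglyMeasurable
    -- The product formula already holds for the transforms themselves, before taking moduli.
    rw [← Complex.norm_prod]
    congr 1
    simp_rw [hsm]
    have h1 := (integral_foldr_conv hξ (by simp)
      (fun x y => by simp [AddChar.map_add_eq_mul]) (List.ofFn fun i => μ.map (T i))
      (fun ρ hρ => by
        obtain ⟨i, rfl⟩ := List.mem_ofFn.1 hρ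
        exact Measure.isProbabilityMeasure_map (T i).continuous.measurable.aemeasurable)).2
    have h2 : ∫ v, (ψ (ξ (e v)) : ℂ) ∂μ = ∫ v, (ψ (ξ (e v)) : ℂ) ∂(convImages T μ) := by
      rw [← hconv]
    rw [h2, convImages, h1, List.map_ofFn, List.prod_ofFn]
    refine Finset.prod_congr rfl fun i _ => ?_
    simp only [Function.comp]
    have hTi : Continuous fun v => T i v := (T i).continuous
    refine (integral_map (φ := fun v => T i v) hTi.measurable.aemeasurable
      (continuous_circle_coe.comp hξ).aestronglyMeasurable).trans ?_
    refine integral_congr_ae (ae_of_all _ fun v => ?_)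
    simp [hS]

end Coordinates

/-- The case `m = 2`; the trailing Dirac mass in `convImages` is neutral for convolution. -/
lemma IsAutophage.exists_convImages {V : Type*} [AddCommGroup V] [TopologicalSpace V]
    [MeasurableSpace V] [MeasurableAdd₂ V] {μ : Measure V} [IsFiniteMeasure μ]
    (h : IsAutophage μ) :
    ∃ T : Fin 2 → V ≃ₜ+ V, (∀ i, IsContraction (T i)) ∧
      (∀ i j, Function.Commute (T i) (T j)) ∧ μ = convImages T μ := by
  obtain ⟨T, S, hT, hS, hc, hμ⟩ := h
  refine ⟨![T, S], ?_, ?_, ?_⟩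
  · intro i
    fin_cases i
    exacts [hT, hS]
  · intro i j
    fin_cases i <;> fin_cases j
    exacts [Function.Commute.refl _, hc, hc.symm, Function.Commute.refl _]
  · simp only [convImages, List.ofFn_succ, List.ofFn_zero, List.foldr_cons, List.foldr_nil,
      Matrix.cons_val_zero, Matrix.cons_val_succ]
    rw [Measure.conv_dirac_zero]
    exact hμ

/-! ### The theorem over each field. -/

theorem real_hasBoundedContinuousDensity {V : Type*} [AddCommGroup V] [Module ℝ V]
    [FiniteDimensional ℝ V] [TopologicalSpace V] [T2Space V] [IsTopologicalAddGroup V]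
    [ContinuousSMul ℝ V] [MeasurableSpace V] [BorelSpace V] (haar : Measure V)
    [haar.IsAddHaarMeasure] (μ : Measure V) [IsProbabilityMeasure μ] (hμ : IsFull ℝ μ) {m : ℕ}
    (T : Fin m → V ≃ₜ+ V) (hT : ∀ i, IsContraction (T i))
    (hcomm : ∀ i j, Function.Commute (T i) (T j)) (hconv : μ = convImages T μ) :
    HasBoundedContinuousDensity μ haar := by
  obtain ⟨d, e, S, hprob, hfull, hS, -, hprod⟩ := exists_coordinates (K := ℝ)
    Rat.denseRange_cast Real.continuous_fourierChar μ hμ T hT hcomm hconv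
  refine HasBoundedContinuousDensity.of_map (ν := volume) e ?_
  exact hasBoundedContinuousDensity_of_integrable Real.continuous_fourierChar
    (isSummabilityKernel_gaussian d)
    (integrable_dualCharFun Real.continuous_fourierChar _ _ hS hprod fun ξ hξ =>
      real_eq_zero_of_mem_phaseSubgroup Real.continuous_fourierChar fourierChar_ne_one hfull hS
        hprod hξ)

theorem padic_hasBoundedContinuousDensity {p : ℕ} [Fact p.Prime] {V : Type*} [AddCommGroup V]
    [Module ℚ_[p] V] [FiniteDimensional ℚ_[p] V] [TopologicalSpace V] [T2Space V]
    [IsTopologicalAddGroup V] [ContinuousSMul ℚ_[p] V] [MeasurableSpace V] [BorelSpace V]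
    (haar : Measure V) [haar.IsAddHaarMeasure] (μ : Measure V) [IsProbabilityMeasure μ]
    (hμ : IsFull ℚ_[p] μ) {m : ℕ} (T : Fin m → V ≃ₜ+ V) (hT : ∀ i, IsContraction (T i))
    (hcomm : ∀ i j, Function.Commute (T i) (T j)) (hconv : μ = convImages T μ) :
    HasBoundedContinuousDensity μ haar := by
  let _ : MeasurableSpace ℚ_[p] := borel _
  have : BorelSpace ℚ_[p] := ⟨rfl⟩
  obtain ⟨ψ, hψint, hψp⟩ := exists_padic_addChar p
  have hψ : Continuous ψ := continuous_padic_addChar hψint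
  have hψ1 : ψ ≠ 1 := fun h => hψp (AddChar.eq_one_iff.1 h _)
  obtain ⟨d, e, S, hprob, hfull, hS, hScomm, hprod⟩ := exists_coordinates (K := ℚ_[p])
    (Padic.denseRange_ratCast p) hψ μ hμ T hT hcomm hconv
  refine HasBoundedContinuousDensity.of_map (ν := Measure.addHaar) e ?_
  exact hasBoundedContinuousDensity_of_integrable hψ
    (isSummabilityKernel_ball hψint hψp d Measure.addHaar)
    (integrable_dualCharFun hψ _ _ hS hprod fun ξ hξ =>
      padic_eq_zero_of_mem_phaseSubgroup hψ hψ1 hfull hS hScomm hprod hξ)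

/-- A finite-dimensional Hausdorff vector space over a second countable complete field has
measurable addition. -/
lemma measurableAdd₂_of_finiteDimensional (K : Type*) {V : Type*} [NontriviallyNormedField K]
    [CompleteSpace K] [SecondCountableTopology K] [AddCommGroup V] [Module K V]
    [FiniteDimensional K V] [TopologicalSpace V] [T2Space V] [IsTopologicalAddGroup V]
    [ContinuousSMul K V] [MeasurableSpace V] [BorelSpace V] : MeasurableAdd₂ V := by
  have : SecondCountableTopology V :=
    (Module.finBasis K V).equivFunL.toHomeomorph.secondCountableTopology
  infer_instance

theorem theorem5p3 :
    -- real vector spaces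
    (∀ (V : Type*) [AddCommGroup V] [Module ℝ V] [FiniteDimensional ℝ V]
        [TopologicalSpace V] [T2Space V] [IsTopologicalAddGroup V] [ContinuousSMul ℝ V]
        [MeasurableSpace V] [BorelSpace V]
        (haar : Measure V) [haar.IsAddHaarMeasure]
        (μ : Measure V) [IsProbabilityMeasure μ], IsFull ℝ μ →
      (∀ (m : ℕ) (T : Fin m → V ≃ₜ+ V), (∀ i, IsContraction (T i)) →
        (∀ i j, Function.Commute (T i) (T j)) → μ = convImages T μ →
          HasBoundedContinuousDensity μ haar) ∧
      (IsAutophage μ → HasBoundedContinuousDensity μ haar)) ∧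
    -- `p`-adic vector spaces
    (∀ (p : ℕ) [Fact p.Prime]
        (V : Type*) [AddCommGroup V] [Module ℚ_[p] V] [FiniteDimensional ℚ_[p] V]
        [TopologicalSpace V] [T2Space V] [IsTopologicalAddGroup V] [ContinuousSMul ℚ_[p] V]
        [MeasurableSpace V] [BorelSpace V]
        (haar : Measure V) [haar.IsAddHaarMeasure]
        (μ : Measure V) [IsProbabilityMeasure μ], IsFull ℚ_[p] μ →
      (∀ (m : ℕ) (T : Fin m → V ≃ₜ+ V), (∀ i, IsContraction (T i)) →
        (∀ i j, Function.Commute (T i) (T j)) → μ = convImages T μ →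
          HasBoundedContinuousDensity μ haar) ∧
      (IsAutophage μ → HasBoundedContinuousDensity μ haar)) := by
  refine ⟨?_, ?_⟩
  · intro V _ _ _ _ _ _ _ _ _ haar _ μ _ hμ
    refine ⟨fun m T hT hcomm hconv => real_hasBoundedContinuousDensity haar μ hμ T hT hcomm hconv,
      fun h => ?_⟩
    have := measurableAdd₂_of_finiteDimensional ℝ (V := V)
    obtain ⟨T, hT, hcomm, hconv⟩ := h.exists_convImages
    exact real_hasBoundedContinuousDensity haar μ hμ T hT hcomm hconv
  · intro p _ V _ _ _ _ _ _ _ _ _ haar _ μ _ hμ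
    refine ⟨fun m T hT hcomm hconv => padic_hasBoundedContinuousDensity haar μ hμ T hT hcomm hconv,
      fun h => ?_⟩
    have := measurableAdd₂_of_finiteDimensional ℚ_[p] (V := V)
    obtain ⟨T, hT, hcomm, hconv⟩ := h.exists_convImages
    exact padic_hasBoundedContinuousDensity haar μ hμ T hT hcomm hconv
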